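/- **Series.** Let $\mathbf R$ be an ordered field and $(\mathfrak N,\cdot,1,\prec)$ a linearly ordered Abelian group, possibly a proper class. Let $\mathbb T=\mathbf R[[\mathfrak N]]$ be the ordered field of formal series $s=\sum_{\mathfrak m} s(\mathfrak m)\mathfrak m$ whose support $\operatorname{supp}s$ is a set that is well-ordered for the reverse order of $\mathfrak N$; a nonzero $s$ is positive when the coefficient of its dominant monomial $\mathfrak d(s)=\max\operatorname{supp}s$ is positive. Write $s\prec t$ if $r|s|<|t|$ for all $r\in\mathbf R^{>}$, $s\preccurlyeq t$ if $|s|\le r|t|$ for some $r\in\mathbf R^{>}$, and $\mathbb T^{>,\succ}=\{s: s>\mathbf R\}$. A family $(s_i)_{i}$ is *summable* if $\bigcup_i\operatorname{supp}s_i$ is a set that is well-ordered for the reverse order and each monomial lies in finitely many $\operatorname{supp}s_i$; its sum is then taken coefficientwise. A map is *strongly linear* if it is $\mathbf R$-linear and preserves summability and sums of summable families. **Setting.** Fix $(\mathbb T,\log,\partial,\circ,x)$ such that: 1. $\log:(\mathbb T^{>},\cdot,<)\to(\mathbb T,+,<)$ is an embedding of ordered groups, $\operatorname{supp}\log\mathfrak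 m\succ1$ for $\mathfrak m\in\mathfrak N$, $\log s\le s-1$ for $s>0$, $\log(1+\varepsilon)=\sum_{k>0}\frac{(-1)^{k+1}}k\varepsilon^k$ for $\varepsilon\prec1$, and $\log$ restricts to an isomorphism $\mathbf R^{>}\to\mathbf R$. Moreover $\log$ is onto $\mathbb T$. For $s,t\neq0$, say that $s$ is *strictly flatter* (resp. *flatter*) than $t$ if $\log|s|\prec\log|t|$ (resp. $\log|s|\preccurlyeq\log|t|$). 2. With $\exp$ the inverse of $\log{\upharpoonright}\mathbf R^{>}$, $(\mathbf R,+,\cdot,0,1,<,\exp)$ is a model of the first-order theory of $\mathbb R_{\exp}$. 3. $\partial:\mathbb T\to\mathbb T$, $s\mapsto s'$, is a surjective strongly linear derivation with $(\log|s|)'=s'/s$ for $s\neq0$; its kernel is $\mathbf R$, and $f'>0$ for all $f\in\mathbb T^{>,\succ}$; $x>0$, $1\notin\operatorname{supp}x$ and $x'=1$. It is flat: every $\mathfrak n\in\operatorname{supp}\mathfrak m'$ ($\mathfrak m\in\mathfrak N$) can be written $\mathfrak n=\mathfrak m\mathfrak f\mathfrak w$ with $\mathfrak f,\mathfrak w\in\mathfrak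 N$, $\mathfrak f$ strictly flatter than $\mathfrak m$ and $\mathfrak w$ flatter than $x$. 4. $\circ:\mathbb T\times\mathbb T^{>,\succ}\to\mathbb T$ is such that each $f\mapsto f\circ s$ is a strongly linear morphism of ordered rings commuting with $\log$, $f\circ(s\circ t)=(f\circ s)\circ t$, and $x\in\mathbb T^{>,\succ}$ is an identity: $x\circ s=s$, $f\circ x=f$. It is flat: for $s\in\mathbb T^{>,\succ}$ and $\mathfrak m\in\mathfrak N\setminus\{1\}$, every $\mathfrak n\in\operatorname{supp}(\mathfrak m\circ s)$ can be written $\mathfrak n=\mathfrak d(\mathfrak m\circ s)\mathfrak f\mathfrak w$ with $\mathfrak f,\mathfrak w\in\mathfrak N$, $\mathfrak f$ strictly flatter than $\mathfrak m$, $\mathfrak w\preccurlyeq1$, and $\mathfrak w$ flatter than some $\mathfrak u\in\operatorname{supp}s$. 5. Chain rule: $(f\circ s)'=s'\cdot(f'\circ s)$ for $f\in\mathbb T$, $s\in\mathbb T^{>,\succ}$. 6. Taylor expansions: if $f,\delta\in\mathbb T$, $s\in\mathbb T^{>,\succ}$, $\delta\prec s$ and $(\mathfrak m'\circ s)\delta\prec\mathfrak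 m\circ s$ for all $\mathfrak m\in\operatorname{supp}f$, then the family $((\mathfrak m^{(k)}\circ s)\delta^k)_{\mathfrak m\in\operatorname{supp}f,\,k\in\mathbb N}$ is summable, $f\circ(s+\delta)=\sum_k\frac{f^{(k)}\circ s}{k!}\delta^k=\sum_{\mathfrak m,k}f(\mathfrak m)\frac{\mathfrak m^{(k)}\circ s}{k!}\delta^k$ (sums of summable families), and $(f^{(k+1)}\circ s)\delta^{k+1}\prec(f^{(k)}\circ s)\delta^k$ whenever the right-hand side is nonzero. 7. Monotonicity: for $f\in\mathbb T\setminus\mathbf R$, the map $s\mapsto f\circ s$ on $\mathbb T^{>,\succ}$ is strictly increasing if $f'>0$ and strictly decreasing if $f'<0$. 8. $(\mathbb T^{>,\succ},\circ,x)$ is a group. Let $\mathfrak M\subseteq\mathfrak N$ be a subgroup containing $x$ (so $x$ is a monomial) and let $\mathbb S=\mathbf R[[\mathfrak M]]$ be the field of series in $\mathbb T$ with support in $\mathfrak M$. Assume that $\partial(\mathbb S)=\mathbb S$, that $\mathbb S$ is closed under $\circ$, and that $(\mathbb S^{>,\succ},\circ,x)$ is a group, where $\mathbb S^{>,\succ}=\mathbb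 S\cap\mathbb T^{>,\succ}$. A *steep conjugate* of $\mathbb S$ is a field $\mathbb U=\mathbf R[[\mathfrak U]]$, where $\mathfrak U\subseteq\mathfrak M$ is a subgroup containing $x$, such that $\partial(\mathbb U)\subseteq\mathbb U$, $x$ is flatter than every $\mathfrak u\in\mathfrak U\setminus\{1\}$, and for all $f\in\mathbb S^{>,\succ}$ with $f>x$ there are $V\in\mathbb S^{>,\succ}$ and $\varepsilon\in\mathbb U$ with $0<\varepsilon\prec1$ and $V\circ f=(x+\varepsilon)\circ V$. **Theorem 4.6 and its consequence.** Assume that $\mathbb S$ has a steep conjugate. Then for every $f\in\mathbb S^{>,\succ}$ with $f>x$ there is a $V\in\mathbb S^{>,\succ}$ with $V\circ f=V+1$. Consequently, $(\mathbb S^{>,\succ},\circ,x,<)$ is a linearly bi-ordered group with exactly three conjugacy classes, and it is simple. -/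

import Mathlib

universe u w

namespace Transseries

/-! ### The ordered exponential language -/

/-- Function symbols of the language of ordered exponential rings. -/
inductive ExpFunc : ℕ → Type
  | zero : ExpFunc 0
  | one : ExpFunc 0
  | add : ExpFunc 2
  | mul : ExpFunc 2
  | exp : ExpFunc 1

/-- Relation symbols of the language of ordered exponential rings. -/
inductive ExpRel : ℕ → Type
  | lt : ExpRel 2

/-- The first-order language `(+, ·, 0, 1, <, exp)`. -/
def expLanguage : FirstOrder.Language := ⟨ExpFunc, ExpRel⟩

/-- A field `K` with an order and a function `e : K → K`, as a structure `(K, +, ·, 0, 1, <, e)`. -/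
@[reducible] def expStructure (K : Type w) [Field K] [LinearOrder K] (e : K → K) :
    expLanguage.Structure K where
  funMap := fun {_} f v => match f with
    | ExpFunc.zero => 0
    | ExpFunc.one => 1
    | ExpFunc.add => v 0 + v 1
    | ExpFunc.mul => v 0 * v 1
    | ExpFunc.exp => e (v 0)
  RelMap := fun {_} r v => match r with
    | ExpRel.lt => v 0 < v 1

/-- `(K, +, ·, 0, 1, <, e)` is a model of the complete first-order theory of `ℝ_exp`. -/
def IsModelOfThRexp (K : Type w) [Field K] [LinearOrder K] (e : K → K) : Prop :=
  @FirstOrder.Language.Theory.Model expLanguage K (expStructure K e)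
    (@FirstOrder.Language.completeTheory expLanguage ℝ (expStructure ℝ Real.exp))

/-! ### Fields of well-based series

The group of monomials may be a proper class, while supports of series are sets. So monomials
form a type in the universe `u + 1`, and supports are `u`-small. The group is written additively
with the reverse order: the monomial with exponent `γ` is `t ^ γ`, where `t` is infinitesimal,
and `t ^ γ ≺ t ^ δ` if and only if `δ < γ`. -/

section Series

variable (Γ : Type (u + 1)) [AddCommGroup Γ] [LinearOrder Γ] [IsOrderedAddMonoid Γ]
  (R : Type w) [Field R]

theorem small_inv_support (s : HahnSeries Γ R) (hs : Small.{u} s.support) :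
    Small.{u} (s⁻¹).support := by
  rw [Cardinal.small_iff_lift_mk_lt_univ] at hs ⊢
  rw [Cardinal.lift_id] at hs ⊢
  refine (HahnSeries.cardSupp_inv_le s).trans_lt (max_lt ?_ hs)
  exact Cardinal.aleph0_lt_univ

variable [LinearOrder R] [IsStrictOrderedRing R]

/-- The series with `u`-small support form a subfield of the Hahn series. The order is the
lexicographic one: a nonzero series is positive when its dominant coefficient is. -/
def smallSeries : Subfield (Lex (HahnSeries Γ R)) where
  carrier := {s | Small.{u} (ofLex s).support}
  zero_mem' := by
    change Small.{u} (0 : HahnSeries Γ R).support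
    rw [HahnSeries.support_zero]
    infer_instance
  one_mem' := by
    change Small.{u} (1 : HahnSeries Γ R).support
    exact small_subset (s := {(0 : Γ)}) HahnSeries.support_single_subset
  add_mem' := by
    intro a b ha hb
    have ha' : Small.{u} (ofLex a).support := ha
    have hb' : Small.{u} (ofLex b).support := hb
    exact small_subset (s := (ofLex a).support ∪ (ofLex b).support)
      (HahnSeries.support_add_subset _ _)
  mul_mem' := by
    intro a b ha hb
    have ha' : Small.{u} (ofLex a).support := ha
    have hb' : Small.{u} (ofLex b).support := hb
    have h : Small.{u} (Set.image2 (· + ·) (ofLex a).support (ofLex b).support) :=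
      small_image2 _ _ _
    exact small_subset (HahnSeries.support_mul_subset (x := ofLex a) (y := ofLex b))
  neg_mem' := by
    intro a ha
    have ha' : Small.{u} (ofLex a).support := ha
    change Small.{u} (-(ofLex a)).support
    rw [HahnSeries.support_neg]
    exact ha'
  inv_mem' := by
    intro a ha
    exact small_inv_support Γ R (ofLex a) ha

/-- The ordered field of well-based series over `R` with monomials indexed by `Γ`. -/
abbrev Series : Type (max (u + 1) w) := smallSeries Γ R

end Series

variable {Γ : Type (u + 1)} [AddCommGroup Γ] [LinearOrder Γ] [IsOrderedAddMonoid Γ]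
  {R : Type w} [Field R] [LinearOrder R] [IsStrictOrderedRing R]

/-- The coefficient of `s` at the monomial `t ^ γ`. -/
def coeff (s : Series Γ R) (γ : Γ) : R := (ofLex s.1).coeff γ

/-- The set of exponents of the monomials in the support of `s`. -/
def supp (s : Series Γ R) : Set Γ := {γ | coeff s γ ≠ 0}

/-- The exponent of the dominant monomial of a nonzero series. -/
noncomputable def domExp (s : Series Γ R) : Γ := (ofLex s.1).order

/-- The term `r t ^ γ`. -/
noncomputable def term (γ : Γ) (r : R) : Series Γ R :=
  ⟨toLex (HahnSeries.single γ r), by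
    change Small.{u} (HahnSeries.single γ r).support
    exact small_subset (s := {γ}) HahnSeries.support_single_subset⟩

/-- The monomial `t ^ γ`. -/
noncomputable def mono (γ : Γ) : Series Γ R := term γ 1

/-- The constant series `r`. -/
noncomputable def const (r : R) : Series Γ R := term (0 : Γ) r

/-- `s ≺ t`. -/
def Prec (s t : Series Γ R) : Prop := ∀ r : R, 0 < r → const r * |s| < |t|

/-- `s ≼ t`. -/
def PrecEq (s t : Series Γ R) : Prop := ∃ r : R, 0 < r ∧ |s| ≤ const r * |t|

/-- `s` is positive infinite, i.e. larger than all constants. -/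
def PosInf (s : Series Γ R) : Prop := ∀ r : R, const r < s

/-! ### Summability and strong linearity -/

/-- The union of the supports is a well-based set, and each monomial lies in finitely many
supports. -/
structure IsSummable {I : Type*} (a : I → Series Γ R) : Prop where
  small : Small.{u} (⋃ i, supp (a i) : Set Γ)
  isWF : (⋃ i, supp (a i)).IsWF
  finite : ∀ γ : Γ, {i | γ ∈ supp (a i)}.Finite

/-- The family `a` is summable with sum `b`. -/
def IsSumOf {I : Type*} (a : I → Series Γ R) (b : Series Γ R) : Prop :=
  IsSummable a ∧ ∀ γ : Γ, coeff b γ = ∑ᶠ i, coeff (a i) γ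

/-- `R`-linear maps which preserve sums of summable families. -/
structure IsStronglyLinear (Φ : Series Γ R → Series Γ R) : Prop where
  map_add : ∀ s t, Φ (s + t) = Φ s + Φ t
  map_const_mul : ∀ (r : R) (s), Φ (const r * s) = const r * Φ s
  map_sum : ∀ (I : Type (u + 1)) (a : I → Series Γ R) (b : Series Γ R),
    IsSumOf a b → IsSumOf (fun i => Φ (a i)) (Φ b)

/-! ### Transserial fields (the logarithm is a total function whose values are only used at
positive series) -/

structure IsTransserialField (log : Series Γ R → Series Γ R) : Prop where
  log_mul : ∀ s t, 0 < s → 0 < t → log (s * t) = log s + log t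
  log_lt_log : ∀ s t, 0 < s → s < t → log s < log t
  /-- Logarithms of monomials are purely infinite. -/
  log_mono : ∀ γ : Γ, ∀ δ ∈ supp (log (mono γ)), δ < 0
  log_le : ∀ s, 0 < s → log s ≤ s - 1
  log_one_add : ∀ ε, Prec ε 1 →
    IsSumOf (fun k : ℕ => const ((-1) ^ k / ((k : R) + 1)) * ε ^ (k + 1)) (log (1 + ε))
  log_const : ∀ r : R, 0 < r → ∃ a : R, log (const r) = const a
  log_const_surj : ∀ a : R, ∃ r : R, 0 < r ∧ log (const r) = const a

/-- The exponential, as the partial inverse of the logarithm, is total. -/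
def IsExpClosed (log : Series Γ R → Series Γ R) : Prop :=
  ∀ t, ∃ s, 0 < s ∧ log s = t

/-- `e` is the exponential on the field of constants, i.e. the inverse of `log`. -/
def IsConstExp (log : Series Γ R → Series Γ R) (e : R → R) : Prop :=
  ∀ a : R, 0 < e a ∧ log (const (e a)) = const a

/-- `s` is strictly flatter than `t`, for nonzero `s` and `t`. -/
def StrictlyFlatter (log : Series Γ R → Series Γ R) (s t : Series Γ R) : Prop :=
  Prec (log |s|) (log |t|)

/-- `s` is flatter than `t`, for nonzero `s` and `t`. -/
def Flatter (log : Series Γ R → Series Γ R) (s t : Series Γ R) : Prop :=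
  PrecEq (log |s|) (log |t|)

/-! ### Derivations -/

structure IsTransserialDerivation (log der : Series Γ R → Series Γ R) : Prop where
  stronglyLinear : IsStronglyLinear der
  leibniz : ∀ s t, der (s * t) = der s * t + s * der t
  der_log : ∀ s, s ≠ 0 → der (log |s|) = der s / s

/-- `x` is an identity of the derivation. -/
def IsDerIdentity (der : Series Γ R → Series Γ R) (x : Series Γ R) : Prop :=
  0 < x ∧ (0 : Γ) ∉ supp x ∧ der x = 1

structure IsHField (der : Series Γ R → Series Γ R) : Prop where
  ker : ∀ s, der s = 0 ↔ ∃ r : R, s = const r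
  der_pos : ∀ f, PosInf f → 0 < der f

/-- Each monomial `n` in the support of the derivative of a monomial `m` is of the form
`n = m f w` where `f` is strictly flatter than `m` and `w` is flatter than `x`. -/
def IsFlatDer (log der : Series Γ R → Series Γ R) (x : Series Γ R) : Prop :=
  ∀ m : Γ, ∀ n ∈ supp (der (mono m)), ∃ f v : Γ,
    StrictlyFlatter log (mono f) (mono m) ∧ Flatter log (mono v) x ∧ n = m + f + v

/-! ### Composition laws (a total function `comp f s`, standing for `f ∘ s`, whose values are only
used for positive infinite `s`) -/

structure IsTransserialComp (log : Series Γ R → Series Γ R)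
    (comp : Series Γ R → Series Γ R → Series Γ R) : Prop where
  stronglyLinear : ∀ s, PosInf s → IsStronglyLinear (fun f => comp f s)
  comp_one : ∀ s, PosInf s → comp 1 s = 1
  comp_mul : ∀ s, PosInf s → ∀ f g, comp (f * g) s = comp f s * comp g s
  comp_mono : ∀ s, PosInf s → ∀ f g, f ≤ g → comp f s ≤ comp g s
  comp_log : ∀ s, PosInf s → ∀ f, 0 < f → comp (log f) s = log (comp f s)
  assoc : ∀ s t, PosInf s → PosInf t → ∀ f, comp f (comp s t) = comp (comp f s) t

/-- `x` is an identity of the composition law. -/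
def IsCompIdentity (comp : Series Γ R → Series Γ R → Series Γ R) (x : Series Γ R) : Prop :=
  PosInf x ∧ (∀ s, PosInf s → comp x s = s) ∧ ∀ f, comp f x = f

/-- For each monomial `m ≠ 1`, each monomial `n` in the support of `m ∘ s` is the product of the
dominant monomial of `m ∘ s` with `f w`, where `f` is strictly flatter than `m`, and `w ≼ 1` is
flatter than some `p` in the support of `s`. -/
def IsFlatComp (log : Series Γ R → Series Γ R)
    (comp : Series Γ R → Series Γ R → Series Γ R) : Prop :=
  ∀ s, PosInf s → ∀ m : Γ, m ≠ 0 → ∀ n ∈ supp (comp (mono m) s), ∃ f v : Γ,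
    StrictlyFlatter log (mono f : Series Γ R) (mono m) ∧ 0 ≤ v ∧
    (∃ p ∈ supp s, Flatter log (mono v : Series Γ R) (mono p)) ∧
    n = domExp (comp (mono m) s) + f + v

/-- The chain rule. -/
def ChainRule (der : Series Γ R → Series Γ R)
    (comp : Series Γ R → Series Γ R → Series Γ R) : Prop :=
  ∀ f s, PosInf s → der (comp f s) = der s * comp (der f) s

def TaylorConfiguration (der : Series Γ R → Series Γ R)
    (comp : Series Γ R → Series Γ R → Series Γ R) (f s δ : Series Γ R) : Prop :=
  Prec δ s ∧ ∀ m ∈ supp f, Prec (comp (der (mono m)) s * δ) (comp (mono m) s)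

/-- The conclusion of the Taylor expansion of `f` at `(s, δ)`. In the last condition, once a term
of the Taylor series vanishes, so do all the following ones. -/
structure TaylorExpansion (der : Series Γ R → Series Γ R)
    (comp : Series Γ R → Series Γ R → Series Γ R) (f s δ : Series Γ R) : Prop where
  summable : IsSummable
    (fun p : supp f × ℕ => comp (der^[p.2] (mono p.1.1)) s * δ ^ p.2)
  sum_der : IsSumOf
    (fun k : ℕ => const ((k.factorial : R)⁻¹) * (comp (der^[k] f) s * δ ^ k)) (comp f (s + δ))
  sum_mono : IsSumOf
    (fun p : supp f × ℕ => const (coeff f p.1.1 * (p.2.factorial : R)⁻¹) *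
      (comp (der^[p.2] (mono p.1.1)) s * δ ^ p.2)) (comp f (s + δ))
  decreasing : ∀ k : ℕ, comp (der^[k] f) s * δ ^ k ≠ 0 →
    Prec (comp (der^[k + 1] f) s * δ ^ (k + 1)) (comp (der^[k] f) s * δ ^ k)

def HasTaylorExpansions (der : Series Γ R → Series Γ R)
    (comp : Series Γ R → Series Γ R → Series Γ R) : Prop :=
  ∀ f s δ, PosInf s → TaylorConfiguration der comp f s δ → TaylorExpansion der comp f s δ

/-- Right composition with `f ∘ ·` is strictly monotone for non-constant `f`, in the direction
given by the sign of the derivative of `f`. -/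
def IsMonotoneComp (der : Series Γ R → Series Γ R)
    (comp : Series Γ R → Series Γ R → Series Γ R) : Prop :=
  ∀ f, (∀ r : R, f ≠ const r) →
    (0 < der f → ∀ s t, PosInf s → PosInf t → s < t → comp f s < comp f t) ∧
    (der f < 0 → ∀ s t, PosInf s → PosInf t → s < t → comp f t < comp f s)

/-- `(G, ∘, x)` is a group. -/
structure IsGroupUnder (comp : Series Γ R → Series Γ R → Series Γ R) (x : Series Γ R)
    (G : Set (Series Γ R)) : Prop where
  comp_mem : ∀ f ∈ G, ∀ g ∈ G, comp f g ∈ G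
  id_mem : x ∈ G
  assoc : ∀ f ∈ G, ∀ g ∈ G, ∀ h ∈ G, comp (comp f g) h = comp f (comp g h)
  id_comp : ∀ f ∈ G, comp x f = f
  comp_id : ∀ f ∈ G, comp f x = f
  exists_inv : ∀ f ∈ G, ∃ g ∈ G, comp g f = x ∧ comp f g = x

/-- The group `(G, ∘, x)`. -/
@[reducible] noncomputable def IsGroupUnder.group
    {comp : Series Γ R → Series Γ R → Series Γ R} {x : Series Γ R} {G : Set (Series Γ R)}
    (h : IsGroupUnder comp x G) : Group G where
  mul f g := ⟨comp f.1 g.1, h.comp_mem f.1 f.2 g.1 g.2⟩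
  one := ⟨x, h.id_mem⟩
  inv f := ⟨(h.exists_inv f.1 f.2).choose, (h.exists_inv f.1 f.2).choose_spec.1⟩
  mul_assoc f g k := Subtype.ext (h.assoc f.1 f.2 g.1 g.2 k.1 k.2)
  one_mul f := Subtype.ext (h.id_comp f.1 f.2)
  mul_one f := Subtype.ext (h.comp_id f.1 f.2)
  inv_mul_cancel f := Subtype.ext (h.exists_inv f.1 f.2).choose_spec.2.1

/-! ### The setting of the conjugacy problem -/

structure IsConjugacySetting (log der : Series Γ R → Series Γ R)
    (comp : Series Γ R → Series Γ R → Series Γ R) (x : Series Γ R) : Prop where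
  transserialField : IsTransserialField log
  model : ∃ e : R → R, IsConstExp log e ∧ IsModelOfThRexp R e
  expClosed : IsExpClosed log
  derivation : IsTransserialDerivation log der
  der_surjective : Function.Surjective der
  derIdentity : IsDerIdentity der x
  flatDer : IsFlatDer log der x
  hField : IsHField der
  composition : IsTransserialComp log comp
  compIdentity : IsCompIdentity comp x
  flatComp : IsFlatComp log comp
  taylor : HasTaylorExpansions der comp
  chainRule : ChainRule der comp
  group : IsGroupUnder comp x {f | PosInf f}
  monotone : IsMonotoneComp der comp

/-- The subfield of series whose monomials lie in the subgroup `M`. -/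
def seriesOver (R : Type w) [Field R] [LinearOrder R] [IsStrictOrderedRing R]
    (M : AddSubgroup Γ) : Set (Series Γ R) :=
  {f | supp f ⊆ M}

/-- The positive infinite series whose monomials lie in `M`. -/
def posInfOver (R : Type w) [Field R] [LinearOrder R] [IsStrictOrderedRing R]
    (M : AddSubgroup Γ) : Set (Series Γ R) :=
  {f | f ∈ seriesOver R M ∧ PosInf f}

/-- Conditions on the subfield of series over `M`: `x` is a monomial in `M`, the subfield is
preserved by the derivation, which is surjective on it, it is closed under composition, and its
positive infinite elements form a group. -/
structure IsConjugacySubfield (der : Series Γ R → Series Γ R)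
    (comp : Series Γ R → Series Γ R → Series Γ R) (x : Series Γ R) (M : AddSubgroup Γ) :
    Prop where
  x_mem : ∃ ξ ∈ M, x = mono ξ
  der_image : der '' seriesOver R M = seriesOver R M
  comp_mem : ∀ f ∈ seriesOver R M, ∀ g ∈ posInfOver R M, comp f g ∈ seriesOver R M
  group : IsGroupUnder comp x (posInfOver R M)

/-- The series over `U` form a steep subfield of the field of series over `M`. -/
structure IsSteepSubfield (log der : Series Γ R → Series Γ R) (x : Series Γ R)
    (M U : AddSubgroup Γ) : Prop where
  le : U ≤ M
  x_mem : ∃ ξ ∈ U, x = mono ξ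
  der_mem : ∀ f ∈ seriesOver R U, der f ∈ seriesOver R U
  steep : ∀ p ∈ U, p ≠ 0 → Flatter log x (mono p)

/-- The series over `U` form a steep conjugate of the field of series over `M`. -/
structure IsSteepConjugate (log der : Series Γ R → Series Γ R)
    (comp : Series Γ R → Series Γ R → Series Γ R) (x : Series Γ R)
    (M U : AddSubgroup Γ) : Prop where
  steepSubfield : IsSteepSubfield log der x M U
  conj : ∀ f ∈ posInfOver R M, x < f → ∃ V ∈ posInfOver R M,
    ∃ ε ∈ seriesOver R U, Prec ε 1 ∧ 0 < ε ∧ comp V f = comp (x + ε) V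

end Transseries

open Transseries

set_option linter.unusedSectionVars false

namespace Transseries

variable {Γ : Type (u + 1)} [AddCommGroup Γ] [LinearOrder Γ] [IsOrderedAddMonoid Γ]
  {R : Type w} [Field R] [LinearOrder R] [IsStrictOrderedRing R]

/-! ### Coefficients -/

/-! Right composition with an element of the group preserves sums, so the steep conjugate reduces
Abel's equation for `f` to the case `s = x + ε` with `0 < ε ≺ 1`: if `V₀ ∘ f = s ∘ V₀` and `V ∘ s =
V + 1`, then `V ∘ V₀` solves the equation for `f`. It remains to solve `Δ V = 1`, where `Δ h = h ∘ s
- h`. The operator `Δ` is strongly linear and resembles a derivation: it is positive on positive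
infinite series and negative on positive infinitesimals. These signs alone (`IsDerLike`) force `Δ`
to respect `≼` and `≺` whenever the larger side is not of size `1`. So `Δ` can be inverted once each
monomial `μ` of `M` is, up to a constant factor, the leading term of `Δ n` for some monomial `n ≠ 1`
of `M` (`exists_difference_asymp`). Two regimes occur. Since `∂` is onto `𝕊`, there is a monomial
`d` with `ε d' ≍ μ`. If `d ≻ μ`, Taylor expansion gives `Δ d ≍ ε d' ≍ μ`. Otherwise `μ' / μ ≽ 1 /
ε`: the monomial varies so fast that composition with `s` scales `μ` (or `1 / μ`, if `μ` is
infinitesimal) by a factor at least `1 + a > 1`. Then for infinitesimal `μ` one takes `n = μ`, and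
for infinite `μ` the dominant monomial of `μ` composed with the inverse of `s`. The map `μ ↦ n` is
strictly increasing, and the remaining error terms are removed by a well-founded recursion
(`IsStronglyLinear.exists_preimage`). Its support is well-based because a set generated by strictly
increasing, summability-preserving steps is well-founded (`isWF_reach`). Abel's equation says that
every `f > x` is conjugate to `x + 1`. In a bi-ordered group with all elements above `1` conjugate,
the classes are those of `1`, `t` and `t⁻¹`, and a nontrivial normal subgroup contains everything.
Exponents carry the reverse order throughout: a smaller exponent is a larger monomial. -/

theorem series_ext {s t : Series Γ R} (h : ∀ γ, coeff s γ = coeff t γ) : s = t :=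
  Subtype.ext (HahnSeries.ext (funext h))

@[simp] theorem coeff_zero (γ : Γ) : coeff (0 : Series Γ R) γ = 0 := rfl

@[simp] theorem coeff_add (s t : Series Γ R) (γ : Γ) :
    coeff (s + t) γ = coeff s γ + coeff t γ := rfl

@[simp] theorem coeff_neg (s : Series Γ R) (γ : Γ) : coeff (-s) γ = -coeff s γ := rfl

@[simp] theorem coeff_sub (s t : Series Γ R) (γ : Γ) :
    coeff (s - t) γ = coeff s γ - coeff t γ := rfl

theorem coeff_term (δ : Γ) (r : R) (γ : Γ) : coeff (term δ r) γ = if γ = δ then r else 0 := by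
  split_ifs with h
  · subst h
    exact HahnSeries.coeff_single_same _ _
  · exact HahnSeries.coeff_single_of_ne h

theorem coeff_mono (δ γ : Γ) : coeff (mono δ : Series Γ R) γ = if γ = δ then 1 else 0 :=
  coeff_term δ 1 γ

theorem coeff_const (r : R) (γ : Γ) : coeff (const r : Series Γ R) γ = if γ = 0 then r else 0 :=
  coeff_term 0 r γ

@[simp] theorem coeff_const_mul (r : R) (s : Series Γ R) (γ : Γ) :
    coeff (const r * s) γ = r * coeff s γ :=
  HahnSeries.coeff_single_zero_mul

theorem mono_add (γ δ : Γ) : (mono (γ + δ) : Series Γ R) = mono γ * mono δ := by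
  refine Subtype.ext ?_
  have h : HahnSeries.single γ (1 : R) * HahnSeries.single δ 1 = HahnSeries.single (γ + δ) 1 := by
    rw [HahnSeries.single_mul_single, one_mul]
  exact h.symm

theorem mono_zero : (mono 0 : Series Γ R) = 1 := rfl

theorem mono_mul_mono_neg (γ : Γ) : (mono γ * mono (-γ) : Series Γ R) = 1 := by
  rw [← mono_add, add_neg_cancel, mono_zero]

theorem lt_iff_coeff (s t : Series Γ R) :
    s < t ↔ ∃ γ, (∀ δ < γ, coeff s δ = coeff t δ) ∧ coeff s γ < coeff t γ := Iff.rfl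

theorem pos_iff_coeff (s : Series Γ R) :
    0 < s ↔ ∃ γ, (∀ δ < γ, coeff s δ = 0) ∧ 0 < coeff s γ := by
  rw [lt_iff_coeff]
  simp [eq_comm]

theorem mono_pos (γ : Γ) : (0 : Series Γ R) < mono γ := by
  rw [pos_iff_coeff]
  refine ⟨γ, fun δ hδ => ?_, ?_⟩
  · rw [coeff_mono, if_neg hδ.ne]
  · rw [coeff_mono, if_pos rfl]; exact one_pos

theorem mono_ne_zero (γ : Γ) : (mono γ : Series Γ R) ≠ 0 := (mono_pos γ).ne'

theorem supp_isWF (s : Series Γ R) : (supp s).IsWF := (ofLex s.1).isWF_support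

theorem small_supp (s : Series Γ R) : Small.{u} (supp s) := s.2

/-- The series with given coefficients. -/
def ofCoeff (f : Γ → R) (A : Set Γ) (hA : A.IsWF) (hs : Small.{u} A) (hf : ∀ γ ∉ A, f γ = 0) :
    Series Γ R :=
  have hsub : Function.support f ⊆ A := fun γ hγ => by_contra fun h => hγ (hf γ h)
  ⟨toLex ⟨f, (hA.mono hsub).isPWO⟩, small_subset hsub⟩

/-! ### Constants -/

theorem const_one : (const 1 : Series Γ R) = 1 := rfl

theorem const_add (r q : R) : (const (r + q) : Series Γ R) = const r + const q :=
  series_ext fun γ => by simp only [coeff_const, coeff_add]; split_ifs <;> simp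

theorem const_mul (r q : R) : (const (r * q) : Series Γ R) = const r * const q :=
  series_ext fun γ => by simp only [coeff_const, coeff_const_mul]; split_ifs <;> simp

theorem const_zero : (const 0 : Series Γ R) = 0 :=
  series_ext fun γ => by simp [coeff_const]

theorem const_neg (r : R) : (const (-r) : Series Γ R) = -const r :=
  series_ext fun γ => by simp only [coeff_const, coeff_neg]; split_ifs <;> simp

theorem const_sub (r q : R) : (const (r - q) : Series Γ R) = const r - const q := by
  rw [sub_eq_add_neg, const_add, const_neg, ← sub_eq_add_neg]

theorem const_pos {r : R} (hr : 0 < r) : (0 : Series Γ R) < const r := by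
  rw [pos_iff_coeff]
  refine ⟨0, fun δ hδ => ?_, ?_⟩
  · rw [coeff_const, if_neg hδ.ne]
  · rwa [coeff_const, if_pos rfl]

theorem const_lt {r q : R} (h : r < q) : (const r : Series Γ R) < const q := by
  rw [← sub_pos, ← const_sub]
  exact const_pos (sub_pos.2 h)

theorem const_two : (const 2 : Series Γ R) = 2 := by
  rw [← one_add_one_eq_two, const_add, const_one, one_add_one_eq_two]

theorem const_mul_const_inv {r : R} (hr : r ≠ 0) :
    (const r * const r⁻¹ : Series Γ R) = 1 := by
  rw [← const_mul, mul_inv_cancel₀ hr, const_one]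

/-! ### The dominance relations -/

theorem not_precEq_iff {s t : Series Γ R} : ¬ PrecEq s t ↔ Prec t s := by
  simp only [PrecEq, Prec, not_exists, not_and, not_le]

theorem not_prec_iff {s t : Series Γ R} : ¬ Prec s t ↔ PrecEq t s := by
  rw [← not_precEq_iff, not_not]

theorem PrecEq.refl (s : Series Γ R) : PrecEq s s :=
  ⟨1, one_pos, by rw [const_one, one_mul]⟩

theorem PrecEq.trans {s t v : Series Γ R} (h₁ : PrecEq s t) (h₂ : PrecEq t v) : PrecEq s v := by
  obtain ⟨r, hr, h⟩ := h₁
  obtain ⟨q, hq, h'⟩ := h₂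
  refine ⟨r * q, mul_pos hr hq, h.trans ?_⟩
  rw [const_mul, mul_assoc]
  exact mul_le_mul_of_nonneg_left h' (const_pos hr).le

theorem Prec.precEq {s t : Series Γ R} (h : Prec s t) : PrecEq s t :=
  ⟨1, one_pos, by
    have := (h 1 one_pos).le
    rwa [const_one, one_mul] at this ⊢⟩

theorem Prec.trans_precEq {s t v : Series Γ R} (h₁ : Prec s t) (h₂ : PrecEq t v) : Prec s v := by
  rw [← not_precEq_iff] at h₁ ⊢
  exact fun h => h₁ (h₂.trans h)

theorem PrecEq.trans_prec {s t v : Series Γ R} (h₁ : PrecEq s t) (h₂ : Prec t v) : Prec s v := by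
  rw [← not_precEq_iff] at h₂ ⊢
  exact fun h => h₂ (h.trans h₁)

theorem PrecEq.mul_right {s t : Series Γ R} (h : PrecEq s t) (v : Series Γ R) :
    PrecEq (s * v) (t * v) := by
  obtain ⟨r, hr, h⟩ := h
  refine ⟨r, hr, ?_⟩
  rw [abs_mul, abs_mul, ← mul_assoc]
  exact mul_le_mul_of_nonneg_right h (abs_nonneg v)

theorem PrecEq.mul_left {s t : Series Γ R} (h : PrecEq s t) (v : Series Γ R) :
    PrecEq (v * s) (v * t) := by
  rw [mul_comm v s, mul_comm v t]
  exact h.mul_right v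

theorem precEq_of_le {s t : Series Γ R} (hs : 0 ≤ s) (h : s ≤ t) : PrecEq s t :=
  ⟨1, one_pos, by rwa [const_one, one_mul, abs_of_nonneg hs, abs_of_nonneg (hs.trans h)]⟩

theorem Prec.ne_zero {s t : Series Γ R} (h : Prec s t) : t ≠ 0 := by
  rintro rfl
  have := h 1 one_pos
  rw [const_one, one_mul, abs_zero] at this
  exact absurd this (not_lt.2 (abs_nonneg s))

theorem PrecEq.neg_left {s t : Series Γ R} (h : PrecEq s t) : PrecEq (-s) t := by
  rwa [PrecEq, abs_neg]

theorem PrecEq.neg_right {s t : Series Γ R} (h : PrecEq s t) : PrecEq s (-t) := by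
  rwa [PrecEq, abs_neg]

theorem prec_zero_left {t : Series Γ R} (ht : t ≠ 0) : Prec 0 t := fun r _ => by
  rw [abs_zero, mul_zero]; exact abs_pos.2 ht

theorem PosInf.pos {s : Series Γ R} (h : PosInf s) : 0 < s := by
  simpa [const_zero] using h 0

theorem posInf_iff {s : Series Γ R} : PosInf s ↔ 0 < s ∧ Prec 1 s := by
  constructor
  · refine fun h => ⟨h.pos, fun r _ => ?_⟩
    rw [abs_one, mul_one, abs_of_pos h.pos]
    exact h r
  · rintro ⟨h0, h⟩ r
    rcases le_or_gt r 0 with hr | hr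
    · refine lt_of_le_of_lt ?_ h0
      rcases hr.lt_or_eq with hr | rfl
      · rw [← const_zero]; exact (const_lt hr).le
      · rw [const_zero]
    · simpa [abs_of_pos h0] using h r hr

theorem PosInf.of_le {s t : Series Γ R} (h : PosInf s) (hst : s ≤ t) : PosInf t :=
  fun r => (h r).trans_le hst

theorem PosInf.inv {s : Series Γ R} (h0 : 0 < s) (h : Prec s 1) : PosInf s⁻¹ := by
  have hi : 0 < s⁻¹ := inv_pos.2 h0
  refine posInf_iff.2 ⟨hi, fun r hr => ?_⟩
  have h1 := h r hr
  rw [abs_one, abs_of_pos h0] at h1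
  rw [abs_one, mul_one, abs_of_pos hi]
  by_contra! hc
  have h2 := mul_le_mul_of_nonneg_right hc h0.le
  rw [inv_mul_cancel₀ h0.ne'] at h2
  exact absurd h1 (not_lt.2 h2)

/-! ### Comparison with monomials -/

theorem exists_order {s : Series Γ R} (hs : s ≠ 0) :
    ∃ γ, coeff s γ ≠ 0 ∧ ∀ δ < γ, coeff s δ = 0 := by
  rcases lt_or_gt_of_ne hs with h | h
  · obtain ⟨γ, h₁, h₂⟩ := (pos_iff_coeff _).1 (neg_pos.2 h)
    exact ⟨γ, fun h => by simp [h] at h₂, fun δ hδ => by simpa using h₁ δ hδ⟩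
  · obtain ⟨γ, h₁, h₂⟩ := (pos_iff_coeff _).1 h
    exact ⟨γ, h₂.ne', h₁⟩

theorem coeff_abs_eq_zero {s : Series Γ R} {γ : Γ} : coeff |s| γ = 0 ↔ coeff s γ = 0 := by
  rcases abs_choice s with h | h <;> rw [h]
  rw [coeff_neg, neg_eq_zero]

theorem prec_mono_iff {s : Series Γ R} {γ : Γ} :
    Prec s (mono γ) ↔ ∀ δ ≤ γ, coeff s δ = 0 := by
  constructor
  · intro h
    by_contra! hc
    obtain ⟨δ, hδ, hc⟩ := hc
    have hs : s ≠ 0 := by rintro rfl; exact hc rfl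
    obtain ⟨ι, h₁, h₂⟩ := (pos_iff_coeff _).1 (abs_pos.2 hs)
    have hι : ι ≤ γ := by
      by_contra! hι
      exact hc (coeff_abs_eq_zero.1 (h₁ δ (hδ.trans_lt hι)))
    -- This constant makes the leading coefficient `2`, which exceeds the coefficient of `mono γ` at
    -- `ι`, be it `0` or `1`.
    have := h (2 / coeff |s| ι) (by positivity)
    rw [abs_of_pos (mono_pos (R := R) γ)] at this
    refine absurd this (not_lt.2 (le_of_lt ?_))
    rw [lt_iff_coeff]
    refine ⟨ι, fun δ hδ => ?_, ?_⟩
    · rw [coeff_const_mul, h₁ δ hδ, mul_zero, coeff_mono, if_neg (hδ.trans_le hι).ne]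
    · rw [coeff_const_mul, div_mul_cancel₀ _ h₂.ne', coeff_mono]
      split_ifs <;> norm_num
  · intro h r hr
    rw [abs_of_pos (mono_pos (R := R) γ), lt_iff_coeff]
    refine ⟨γ, fun δ hδ => ?_, ?_⟩
    · rw [coeff_const_mul, coeff_abs_eq_zero.2 (h δ hδ.le), mul_zero, coeff_mono, if_neg hδ.ne]
    · rw [coeff_const_mul, coeff_abs_eq_zero.2 (h γ le_rfl), mul_zero, coeff_mono, if_pos rfl]
      exact one_pos

theorem precEq_mono_iff {s : Series Γ R} {γ : Γ} :
    PrecEq s (mono γ) ↔ ∀ δ < γ, coeff s δ = 0 := by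
  constructor
  · rintro ⟨r, hr, h⟩
    by_contra! hc
    obtain ⟨δ, hδ, hc⟩ := hc
    have hs : s ≠ 0 := by rintro rfl; exact hc rfl
    obtain ⟨ι, h₁, h₂⟩ := (pos_iff_coeff _).1 (abs_pos.2 hs)
    have hι : ι < γ := by
      by_contra! hι
      exact hc (coeff_abs_eq_zero.1 (h₁ δ (hδ.trans_le hι)))
    rw [abs_of_pos (mono_pos (R := R) γ)] at h
    refine absurd h (not_le.2 ?_)
    rw [lt_iff_coeff]
    refine ⟨ι, fun δ hδ => ?_, ?_⟩
    · rw [coeff_const_mul, h₁ δ hδ, coeff_mono, if_neg (hδ.trans hι).ne, mul_zero]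
    · rw [coeff_const_mul, coeff_mono, if_neg hι.ne, mul_zero]
      exact h₂
  · intro h
    have hr : 0 < |coeff |s| γ| + 1 := by positivity
    refine ⟨_, hr, le_of_lt ?_⟩
    rw [abs_of_pos (mono_pos (R := R) γ), lt_iff_coeff]
    refine ⟨γ, fun δ hδ => ?_, ?_⟩
    · rw [coeff_const_mul, coeff_abs_eq_zero.2 (h δ hδ), coeff_mono, if_neg hδ.ne, mul_zero]
    · rw [coeff_const_mul, coeff_mono, if_pos rfl, mul_one]
      exact (le_abs_self _).trans_lt (lt_add_one _)

/-- `s` and `t` have the same dominant monomial. -/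
def Asymp (s t : Series Γ R) : Prop := PrecEq s t ∧ PrecEq t s

theorem Asymp.symm {s t : Series Γ R} (h : Asymp s t) : Asymp t s := ⟨h.2, h.1⟩

theorem Asymp.trans {s t v : Series Γ R} (h₁ : Asymp s t) (h₂ : Asymp t v) : Asymp s v :=
  ⟨h₁.1.trans h₂.1, h₂.2.trans h₁.2⟩

theorem asymp_mono_iff {s : Series Γ R} {γ : Γ} :
    Asymp s (mono γ) ↔ coeff s γ ≠ 0 ∧ ∀ δ < γ, coeff s δ = 0 := by
  rw [Asymp, ← not_prec_iff (s := s), precEq_mono_iff, prec_mono_iff]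
  constructor
  · rintro ⟨h₁, h₂⟩
    exact ⟨fun h => h₂ fun δ hδ => hδ.lt_or_eq.elim (h₁ δ) fun e => e ▸ h, h₁⟩
  · rintro ⟨h₁, h₂⟩
    exact ⟨h₂, fun h => h₁ (h γ le_rfl)⟩

theorem exists_asymp_mono {s : Series Γ R} (hs : s ≠ 0) :
    ∃ γ, coeff s γ ≠ 0 ∧ Asymp s (mono γ) := by
  obtain ⟨γ, h⟩ := exists_order hs
  exact ⟨γ, h.1, asymp_mono_iff.2 h⟩

theorem mono_prec_mono {γ δ : Γ} (h : γ < δ) : Prec (mono δ : Series Γ R) (mono γ) :=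
  prec_mono_iff.2 fun ι hι => by rw [coeff_mono, if_neg (hι.trans_lt h).ne]

theorem mono_prec_mono_iff {γ δ : Γ} : Prec (mono δ : Series Γ R) (mono γ) ↔ γ < δ := by
  refine ⟨fun h => ?_, mono_prec_mono⟩
  by_contra! hc
  have := prec_mono_iff.1 h δ hc
  rw [coeff_mono, if_pos rfl] at this
  exact one_ne_zero this

theorem mono_precEq_mono {γ δ : Γ} (h : γ ≤ δ) : PrecEq (mono δ : Series Γ R) (mono γ) :=
  precEq_mono_iff.2 fun ι hι => by rw [coeff_mono, if_neg (hι.trans_le h).ne]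

/-- Subtracting a proper fraction does not change the dominant monomial. -/
theorem asymp_sub {h m : Series Γ R} {a : R} (ha : 0 < a) (h0 : 0 < h)
    (hm : const (1 + a) * h ≤ m) : Asymp (m - h) m := by
  have ha' : (0 : Series Γ R) < const a := const_pos ha
  rw [const_add, const_one, add_mul, one_mul] at hm
  have h1 : 0 < const a * h := mul_pos ha' h0
  have hmh : 0 < m - h := by linarith
  have hm0 : 0 < m := by linarith
  refine ⟨precEq_of_le hmh.le (by linarith), 1 + a⁻¹, by positivity, ?_⟩
  rw [abs_of_pos hmh, abs_of_pos hm0, const_add, const_one]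
  have h2 : h ≤ const a⁻¹ * (m - h) := by
    have := mul_le_mul_of_nonneg_left (show const a * h ≤ m - h by linarith)
      (const_pos (Γ := Γ) (inv_pos.2 ha)).le
    rwa [← mul_assoc, mul_comm (const a⁻¹), const_mul_const_inv ha.ne', one_mul] at this
  linarith

end Transseries

namespace Transseries

/-! ### Sets generated by an increasing relation -/

/-- The set of elements that are reachable from `A` along the steps `p ↦ q ∈ S p`. -/
def reach {α : Type*} (A : Set α) (S : α → Set α) : Set α :=
  {q | ∃ p ∈ A, Relation.ReflTransGen (fun a b => b ∈ S a) p q}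

theorem subset_reach {α : Type*} (A : Set α) (S : α → Set α) : A ⊆ reach A S :=
  fun p hp => ⟨p, hp, .refl⟩

theorem reach_step {α : Type*} {A : Set α} {S : α → Set α} {p q : α} (hp : p ∈ reach A S)
    (hq : q ∈ S p) : q ∈ reach A S := by
  obtain ⟨a, ha, h⟩ := hp
  exact ⟨a, ha, h.tail hq⟩

theorem reach_subset {α : Type*} {A M : Set α} {S : α → Set α} (hA : A ⊆ M)
    (hS : ∀ p ∈ M, S p ⊆ M) : reach A S ⊆ M := by
  rintro q ⟨a, ha, h⟩
  induction h with
  | refl => exact hA ha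
  | tail _ h₂ ih => exact hS _ ih h₂

/-- The reachable set is covered by a countable union of stages, each a small union of small sets.
-/
theorem small_reach {α : Type (u + 1)} (A : Set α) (S : α → Set α) [Small.{u} A]
    [∀ p, Small.{u} (S p)] : Small.{u} (reach A S) := by
  let F : ℕ → Set α := fun n =>
    Nat.rec (motive := fun _ => Set α) A (fun _ B => ⋃ p ∈ B, S p) n
  have hF : ∀ n, Small.{u} ↥(F n) := by
    intro n
    induction n with
    | zero => exact inferInstanceAs (Small.{u} A)
    | succ n ih =>
      change Small.{u} (⋃ p ∈ F n, S p : Set α)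
      infer_instance
  refine small_subset (s := ⋃ n, F n) ?_
  exact reach_subset (fun p hp => Set.mem_iUnion.2 ⟨0, hp⟩) fun p hp q hq => by
    obtain ⟨n, hn⟩ := Set.mem_iUnion.1 hp
    exact Set.mem_iUnion.2 ⟨n + 1, Set.mem_biUnion hn hq⟩

/-- A set that is generated from a well-founded set by an increasing relation is well-founded, if
the images of well-founded sets are so. -/
theorem isWF_reach {α : Type*} [LinearOrder α] {A : Set α} {S : α → Set α} (hA : A.IsWF)
    (hlt : ∀ p ∈ reach A S, ∀ q ∈ S p, p < q)
    (hS : ∀ B ⊆ reach A S, B.IsWF → (⋃ p ∈ B, S p).IsWF) : (reach A S).IsWF := by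
  set T := reach A S with hT
  let J : Set α := {γ | (T ∩ Set.Iic γ).IsWF}
  have hJ : ∀ γ ∈ J, ∀ δ ≤ γ, δ ∈ J := fun γ hγ δ hδ =>
    Set.IsWF.mono hγ (Set.inter_subset_inter_right _ (Set.Iic_subset_Iic.2 hδ))
  -- A descending sequence stays below its first term, and the part of `T` below a point of `J` is
  -- well-founded.
  have hTJ : (T ∩ J).IsWF := by
    rw [Set.isWF_iff_no_descending_seq]
    intro f hf hr
    have h0 := Set.isWF_iff_no_descending_seq.1 (hr 0).2
    exact h0 f hf fun n => ⟨(hr n).1, hf.antitone (Nat.zero_le n)⟩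
  suffices h : T ⊆ J by rwa [Set.inter_eq_left.2 h] at hTJ
  by_contra hc
  -- The places where a path can first leave `J`. As steps increase, each element of `T` outside `J`
  -- lies above one of them.
  let N : Set α := (A ∪ ⋃ p ∈ T ∩ J, S p) \ J
  have hN : N.IsWF := (hA.union (hS _ Set.inter_subset_left hTJ)).mono Set.sdiff_subset
  have hNT : N ⊆ T := by
    rintro q ⟨hq | hq, -⟩
    · exact subset_reach A S hq
    · obtain ⟨p, hp, hq⟩ := Set.mem_iUnion₂.1 hq
      exact reach_step hp.1 hq
  have key : ∀ q ∈ T, q ∉ J → ∃ ν ∈ N, ν ≤ q := by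
    rintro q ⟨a, ha, h⟩
    induction h with
    | refl => exact fun hq => ⟨a, ⟨Or.inl ha, hq⟩, le_rfl⟩
    | @tail p q h₁ h₂ ih =>
      intro hq
      have hp : p ∈ T := ⟨a, ha, h₁⟩
      by_cases hpJ : p ∈ J
      · exact ⟨q, ⟨Or.inr (Set.mem_biUnion (⟨hp, hpJ⟩ : p ∈ T ∩ J) h₂), hq⟩, le_rfl⟩
      · obtain ⟨ν, hν, hle⟩ := ih hpJ
        exact ⟨ν, hν, hle.trans (hlt p hp q h₂).le⟩
  obtain ⟨q, hq, hqJ⟩ := Set.not_subset.1 hc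
  obtain ⟨ν₀, hν₀, -⟩ := key q hq hqJ
  have hne : N.Nonempty := ⟨ν₀, hν₀⟩
  -- Below `min N`, the set `T` adds to `T ∩ J` at most the point `min N`, so `min N` would belong
  -- to `J`.
  refine (hN.min_mem hne).2 ?_
  refine Set.IsWF.mono (hTJ.union (Set.isWF_singleton (a := hN.min hne))) ?_
  rintro γ ⟨hγ, hle⟩
  by_cases hγJ : γ ∈ J
  · exact Or.inl ⟨hγ, hγJ⟩
  · obtain ⟨ν, hν, hνγ⟩ := key γ hγ hγJ
    exact Or.inr (le_antisymm hle ((hN.min_le hne hν).trans hνγ))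

variable {Γ : Type (u + 1)} [AddCommGroup Γ] [LinearOrder Γ] [IsOrderedAddMonoid Γ]
  {R : Type w} [Field R] [LinearOrder R] [IsStrictOrderedRing R]

/-! ### Summable families -/

theorem IsSummable.exists_sum {I : Type*} {a : I → Series Γ R} (h : IsSummable a) :
    ∃ b, IsSumOf a b := by
  refine ⟨ofCoeff (fun γ => ∑ᶠ i, coeff (a i) γ) _ h.isWF h.small fun γ hγ => ?_, h, fun γ => rfl⟩
  refine finsum_eq_zero_of_forall_eq_zero fun i => ?_
  by_contra hi
  exact hγ (Set.mem_iUnion.2 ⟨i, hi⟩)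

theorem IsSumOf.supp_subset {I : Type*} {a : I → Series Γ R} {b : Series Γ R} (h : IsSumOf a b) :
    supp b ⊆ ⋃ i, supp (a i) := by
  intro γ hγ
  by_contra hc
  refine hγ ?_
  rw [h.2 γ]
  refine finsum_eq_zero_of_forall_eq_zero fun i => ?_
  by_contra hi
  exact hc (Set.mem_iUnion.2 ⟨i, hi⟩)

theorem IsSumOf.sub {I : Type*} {a a' : I → Series Γ R} {b b' : Series Γ R} (h : IsSumOf a b)
    (h' : IsSumOf a' b') : IsSumOf (fun i => a i - a' i) (b - b') := by
  have hsub : ∀ i, supp (a i - a' i) ⊆ supp (a i) ∪ supp (a' i) := by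
    intro i γ hγ
    by_contra hc
    simp only [supp, Set.mem_union, Set.mem_ofPred_eq, not_or, not_not] at hc
    exact hγ (by rw [coeff_sub, hc.1, hc.2, sub_zero])
  have hU : (⋃ i, supp (a i - a' i)) ⊆ (⋃ i, supp (a i)) ∪ ⋃ i, supp (a' i) := by
    rw [← Set.iUnion_union_distrib]
    exact Set.iUnion_mono hsub
  have := h.1.small
  have := h'.1.small
  refine ⟨⟨small_subset hU, (h.1.isWF.union h'.1.isWF).mono hU, fun γ => ?_⟩, fun γ => ?_⟩
  · refine ((h.1.finite γ).union (h'.1.finite γ)).subset fun i hi => hsub i hi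
  · simp only [coeff_sub]
    rw [finsum_sub_distrib (h.1.finite γ) (h'.1.finite γ), h.2, h'.2]

theorem IsStronglyLinear.sub {Φ Ψ : Series Γ R → Series Γ R} (hΦ : IsStronglyLinear Φ)
    (hΨ : IsStronglyLinear Ψ) : IsStronglyLinear fun s => Φ s - Ψ s where
  map_add s t := by rw [hΦ.map_add, hΨ.map_add]; ring
  map_const_mul r s := by rw [hΦ.map_const_mul, hΨ.map_const_mul]; ring
  map_sum I a b h := (hΦ.map_sum I a b h).sub (hΨ.map_sum I a b h)

theorem isStronglyLinear_id : IsStronglyLinear fun s : Series Γ R => s :=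
  ⟨fun _ _ => rfl, fun _ _ => rfl, fun _ _ _ h => h⟩

/-- A monotone image of a well-founded set is well-founded, and injectivity leaves at most one term
per monomial. -/
theorem isSummable_terms {A : Set Γ} (hA : A.IsWF) [Small.{u} A] {n : Γ → Γ}
    (hn : StrictMonoOn n A) (c : Γ → R) :
    IsSummable fun p : A => const (c p) * mono (n p) := by
  have hs : ∀ p : A, supp (const (c p) * mono (n p) : Series Γ R) ⊆ {n p} := by
    intro p γ hγ
    by_contra hc
    exact hγ (by rw [coeff_const_mul, coeff_mono, if_neg (show γ ≠ n p from hc), mul_zero])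
  have hU : (⋃ p : A, supp (const (c p) * mono (n p) : Series Γ R)) ⊆ n '' A := by
    refine Set.iUnion_subset fun p γ hγ => ?_
    rw [hs p hγ]
    exact Set.mem_image_of_mem n p.2
  refine ⟨small_subset hU, Set.IsWF.mono ?_ hU, fun γ => ?_⟩
  · exact (hA.isPWO.image_of_monotoneOn hn.monotoneOn).isWF
  · refine Set.Subsingleton.finite fun p hp q hq => Subtype.ext ?_
    exact hn.injOn p.2 q.2 ((hs p hp).symm.trans (hs q hq))

/-! ### Inversion of strongly linear operators -/

/-- A strongly linear operator which induces an increasing bijection on dominant monomials is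
surjective. -/
theorem IsStronglyLinear.exists_preimage {Δ : Series Γ R → Series Γ R} (hΔ : IsStronglyLinear Δ)
    {M : Set Γ} {n : Γ → Γ} (hn : StrictMonoOn n M)
    (hdom : ∀ μ ∈ M, Asymp (Δ (mono (n μ))) (mono μ))
    (hsupp : ∀ μ ∈ M, supp (Δ (mono (n μ))) ⊆ M) (g : Series Γ R) (hg : supp g ⊆ M) :
    ∃ V : Series Γ R, supp V ⊆ n '' M ∧ Δ V = g := by
  let c : Γ → R := fun μ => (coeff (Δ (mono (n μ))) μ)⁻¹
  let B : Γ → Series Γ R := fun μ => mono μ - const (c μ) * Δ (mono (n μ))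
  have hcB : ∀ μ γ, c μ * coeff (Δ (mono (n μ))) γ = (if γ = μ then 1 else 0) - coeff (B μ) γ := by
    intro μ γ
    simp only [B, coeff_sub, coeff_mono, coeff_const_mul]
    ring
  have hB : ∀ μ ∈ M, ∀ γ ∈ supp (B μ), μ < γ := by
    intro μ hμ γ hγ
    obtain ⟨h₁, h₂⟩ := asymp_mono_iff.1 (hdom μ hμ)
    by_contra! hle
    refine hγ ?_
    rw [show B μ = mono μ - const (c μ) * Δ (mono (n μ)) from rfl, coeff_sub, coeff_mono,
      coeff_const_mul]
    rcases hle.lt_or_eq with hlt | rfl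
    · rw [h₂ γ hlt, if_neg hlt.ne, mul_zero, sub_zero]
    · rw [if_pos rfl, inv_mul_cancel₀ h₁, sub_self]
  have hBM : ∀ μ ∈ M, supp (B μ) ⊆ M := by
    intro μ hμ γ hγ
    by_contra hc
    refine hγ ?_
    have h₁ : coeff (Δ (mono (n μ))) γ = 0 := by_contra fun h => hc (hsupp μ hμ h)
    have h₂ : γ ≠ μ := by rintro rfl; exact hc hμ
    rw [show B μ = mono μ - const (c μ) * Δ (mono (n μ)) from rfl, coeff_sub, coeff_mono,
      coeff_const_mul, h₁, if_neg h₂, mul_zero, sub_zero]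
  have hterms : ∀ A ⊆ M, A.IsWF → Small.{u} A → ∀ d : Γ → R,
      ∃ V, IsSumOf (fun p : A => const (d p) * mono (n p)) V :=
    fun A hAM hA _ d => (isSummable_terms hA (hn.mono hAM) d).exists_sum
  -- The errors are a difference of two summable families: the monomials of `A`, and the image under
  -- `Δ` of the summable family `c μ · n μ`.
  have hBsum : ∀ A ⊆ M, A.IsWF → Small.{u} A → IsSummable fun p : A => B p := by
    intro A hAM hA hsA
    obtain ⟨V, hV⟩ := hterms A hAM hA hsA c
    obtain ⟨W, hW⟩ := (isSummable_terms hA (strictMonoOn_id) fun _ => (1 : R)).exists_sum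
    have h := (hW.sub (hΔ.map_sum _ _ _ hV)).1
    simpa only [hΔ.map_const_mul, const_one, one_mul, id] using h
  -- All monomials met when errors are corrected repeatedly, starting from `g`.
  set A := reach (supp g) fun μ => supp (B μ) with hAdef
  have hAM : A ⊆ M := reach_subset hg hBM
  have hAs : Small.{u} A := by
    have := small_supp g
    have : ∀ μ, Small.{u} (supp (B μ)) := fun μ => small_supp _
    exact small_reach _ _
  have hA : A.IsWF := by
    refine isWF_reach (supp_isWF g) (fun p hp q hq => hB p (hAM hp) q hq) fun C hC hCwf => ?_
    have hCs : Small.{u} C := small_subset hC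
    have := (hBsum C (hC.trans hAM) hCwf hCs).isWF
    rwa [Set.iUnion_subtype (fun p => p ∈ C) fun p => supp (B p)] at this
  have wf : WellFounded fun p q : A => p.1 < q.1 := hA
  -- Solves `w q = g q + ∑ w p · (B p) q`. The default `0` is harmless, since `B p` has no
  -- coefficient at `q` unless `p < q`.
  let w : A → R := wf.fix fun q rec =>
    coeff g q + ∑ᶠ p : A, if h : p.1 < q.1 then rec p h * coeff (B p) q else 0
  have hw : ∀ q : A, w q = coeff g q + ∑ᶠ p : A, w p * coeff (B p) q := by
    intro q
    conv_lhs => rw [show w = wf.fix _ from rfl, wf.fix_eq]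
    congr 1
    refine finsum_congr fun p => ?_
    by_cases h : p.1 < q.1
    · rw [dif_pos h]
    · rw [dif_neg h]
      have : coeff (B p) q = 0 := by_contra fun h' => h (hB p (hAM p.2) q h')
      rw [this, mul_zero]
  classical
  let w' : Γ → R := fun γ => if h : γ ∈ A then w ⟨γ, h⟩ else 0
  have hw' : ∀ p : A, w' p = w p := fun p => dif_pos p.2
  -- As `Δ (c p · n p) = p - B p`, the coefficient of `Δ V` at `q` is `w q - ∑ w p · (B p) q = g q`.
  obtain ⟨V, hV⟩ := hterms A hAM hA hAs fun p => w' p * c p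
  refine ⟨V, ?_, ?_⟩
  · refine hV.supp_subset.trans (Set.iUnion_subset fun p γ hγ => ⟨p, hAM p.2, ?_⟩)
    by_contra hc
    exact hγ (by rw [coeff_const_mul, coeff_mono, if_neg (Ne.symm hc), mul_zero])
  refine series_ext fun γ => ?_
  have hfin := (hBsum A hAM hA hAs).finite γ
  rw [(hΔ.map_sum _ _ _ hV).2 γ]
  have e : ∀ p : A, coeff (Δ (const (w' p * c p) * mono (n p))) γ =
      (if γ = p.1 then w p else 0) - w p * coeff (B p) γ := by
    intro p
    rw [hΔ.map_const_mul, coeff_const_mul, mul_assoc, hcB, hw']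
    split_ifs <;> ring
  rw [finsum_congr e, finsum_sub_distrib]
  · by_cases hγ : γ ∈ A
    · rw [finsum_eq_single _ (⟨γ, hγ⟩ : A) fun p hp => if_neg fun h => hp (Subtype.ext h.symm),
        if_pos rfl, hw ⟨γ, hγ⟩, add_sub_cancel_right]
    · have h₁ : ∀ p : A, coeff (B p) γ = 0 := fun p =>
        by_contra fun h => hγ (reach_step p.2 h)
      have h₂ : coeff g γ = 0 := by_contra fun h => hγ (subset_reach _ _ h)
      rw [h₂, finsum_eq_zero_of_forall_eq_zero, finsum_eq_zero_of_forall_eq_zero, sub_zero]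
      · exact fun p => by rw [h₁, mul_zero]
      · exact fun p => if_neg fun h => hγ (by rw [h]; exact p.2)
  · refine (Set.Subsingleton.finite fun p hp q hq => Subtype.ext ?_)
    have h₁ : γ = p.1 := by_contra fun h => hp (if_neg h)
    have h₂ : γ = q.1 := by_contra fun h => hq (if_neg h)
    exact h₁.symm.trans h₂
  · exact hfin.subset fun p hp h => hp (by simp only [h, mul_zero])

/-! ### Operators with the asymptotic properties of a derivation -/

/-- Linear operators which are positive at positive infinite series, and negative at positive
infinitesimal ones. -/
structure IsDerLike (D : Series Γ R → Series Γ R) : Prop where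
  map_add : ∀ s t, D (s + t) = D s + D t
  map_const_mul : ∀ (r : R) (s), D (const r * s) = const r * D s
  pos : ∀ s, PosInf s → 0 < D s
  neg : ∀ s, 0 < s → Prec s 1 → D s < 0

namespace IsDerLike

variable {D : Series Γ R → Series Γ R}

theorem map_neg (hD : IsDerLike D) (s : Series Γ R) : D (-s) = -D s := by
  have := hD.map_const_mul (-1) s
  rwa [const_neg, const_one, neg_one_mul, neg_one_mul] at this

theorem map_sub (hD : IsDerLike D) (s t : Series Γ R) : D (s - t) = D s - D t := by
  rw [sub_eq_add_neg, hD.map_add, hD.map_neg, ← sub_eq_add_neg]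

/-- Both `(r + 1) g ± f` lie between `g` and `(2 r + 1) g`, so they are infinite or infinitesimal
along with `g`, and `D` has a known sign on them. The extra `1` in the constant keeps them above
`g`. -/
theorem abs_map_le {f g : Series Γ R} (hD : IsDerLike D) {r : R} (hr : 0 < r) (hg : 0 < g)
    (hg1 : Prec 1 g ∨ Prec g 1) (h : |f| ≤ const r * g) :
    |D f| ≤ const (r + 1) * |D g| := by
  obtain ⟨h₁, h₂⟩ := abs_le.1 h
  have e : const (r + 1) * g = const r * g + g := by rw [const_add, const_one, add_mul, one_mul]
  rcases hg1 with hg1 | hg1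
  · have hginf : PosInf g := posInf_iff.2 ⟨hg, hg1⟩
    have h₃ := hD.pos _ (hginf.of_le (show g ≤ const (r + 1) * g + f by rw [e]; linarith))
    have h₄ := hD.pos _ (hginf.of_le (show g ≤ const (r + 1) * g - f by rw [e]; linarith))
    rw [hD.map_add, hD.map_const_mul] at h₃
    rw [hD.map_sub, hD.map_const_mul] at h₄
    rw [abs_of_pos (hD.pos _ hginf), abs_le]
    constructor <;> linarith
  · have hsmall : ∀ s, g ≤ s → s ≤ const (2 * r + 1) * g → D s < 0 := by
      intro s hs₁ hs₂
      have hs0 : 0 < s := hg.trans_le hs₁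
      refine hD.neg s hs0 (PrecEq.trans_prec ⟨2 * r + 1, by positivity, ?_⟩ hg1)
      rwa [abs_of_pos hs0, abs_of_pos hg]
    have e' : const (2 * r + 1) * g = const r * g + const r * g + g := by
      rw [two_mul, const_add, const_add, const_one]; ring
    have h₃ := hsmall (const (r + 1) * g + f) (by rw [e]; linarith) (by rw [e, e']; linarith)
    have h₄ := hsmall (const (r + 1) * g - f) (by rw [e]; linarith) (by rw [e, e']; linarith)
    rw [hD.map_add, hD.map_const_mul] at h₃
    rw [hD.map_sub, hD.map_const_mul] at h₄
    rw [abs_of_neg (hD.neg _ hg hg1), abs_le]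
    constructor <;> linarith

theorem precEq {f g : Series Γ R} (hD : IsDerLike D) (hg1 : Prec 1 g ∨ Prec g 1)
    (h : PrecEq f g) : PrecEq (D f) (D g) := by
  obtain ⟨r, hr, h⟩ := h
  rcases lt_trichotomy g 0 with hg | rfl | hg
  · refine ⟨r + 1, by positivity, ?_⟩
    have hg1' : Prec 1 (-g) ∨ Prec (-g) 1 := by simpa only [Prec, abs_neg] using hg1
    have := hD.abs_map_le hr (neg_pos.2 hg) hg1' (by rwa [abs_of_neg hg] at h)
    rwa [hD.map_neg, abs_neg] at this
  · rw [abs_zero, mul_zero] at h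
    rw [abs_nonpos_iff.1 h]
    exact .refl _
  · exact ⟨r + 1, by positivity, hD.abs_map_le hr hg hg1 (by rwa [abs_of_pos hg] at h)⟩

theorem map_ne_zero {g : Series Γ R} (hD : IsDerLike D) (hg : g ≠ 0)
    (hg1 : Prec 1 g ∨ Prec g 1) : D g ≠ 0 := by
  have key : ∀ g, 0 < g → Prec 1 g ∨ Prec g 1 → D g ≠ 0 := by
    rintro g hg (h | h)
    · exact (hD.pos g (posInf_iff.2 ⟨hg, h⟩)).ne'
    · exact (hD.neg g hg h).ne
  rcases lt_or_gt_of_ne hg with h | h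
  · have hg1' : Prec 1 (-g) ∨ Prec (-g) 1 := by simpa only [Prec, abs_neg] using hg1
    have := key _ (neg_pos.2 h) hg1'
    rwa [hD.map_neg, neg_ne_zero] at this
  · exact key g h hg1

theorem prec {f g : Series Γ R} (hD : IsDerLike D) (hg1 : Prec 1 g ∨ Prec g 1)
    (h : Prec f g) : Prec (D f) (D g) := by
  have hDg : 0 < |D g| := abs_pos.2 (hD.map_ne_zero h.ne_zero hg1)
  have hg1' : Prec 1 |g| ∨ Prec |g| 1 := by simpa only [Prec, abs_abs] using hg1
  have hDabs : |D (|g|)| = |D g| := by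
    rcases abs_choice g with e | e <;> rw [e]
    rw [hD.map_neg, abs_neg]
  intro r hr
  -- The bound `1/2` becomes `3/2 < 2` after applying `D`, whence `(2 r + 1) |D f| < 2 |D g|`; this
  -- contradicts `|D g| ≤ r |D f|`.
  have h₁ : |const (2 * r + 1) * f| ≤ const (1 / 2 : R) * |g| := by
    have h₂ := (h (2 * (2 * r + 1)) (by positivity)).le
    have h₃ := mul_le_mul_of_nonneg_left h₂ (const_pos (Γ := Γ) (one_half_pos (α := R))).le
    rwa [← mul_assoc, ← const_mul, ← mul_assoc, one_div_mul_cancel two_ne_zero, one_mul,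
      ← abs_of_pos (const_pos (Γ := Γ) (show (0 : R) < 2 * r + 1 by positivity)), ← abs_mul]
      at h₃
  have h₄ := hD.abs_map_le one_half_pos (abs_pos.2 h.ne_zero) hg1' h₁
  rw [hD.map_const_mul, abs_mul, hDabs,
    abs_of_pos (const_pos (Γ := Γ) (show (0 : R) < 2 * r + 1 by positivity))] at h₄
  by_contra! hc
  have e₁ : (const (2 * r + 1) * |D f| : Series Γ R) = 2 * (const r * |D f|) + |D f| := by
    rw [const_add, const_mul, const_two, const_one]; ring
  have e₂ : (const (1 / 2 + 1) * |D g| : Series Γ R) < 2 * |D g| := by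
    rw [← const_two]
    exact mul_lt_mul_of_pos_right (const_lt (by norm_num)) hDg
  have := abs_nonneg (D f)
  rw [e₁] at h₄
  linarith

theorem asymp {f g : Series Γ R} (hD : IsDerLike D) (hg1 : Prec 1 g ∨ Prec g 1)
    (h : Asymp f g) : Asymp (D f) (D g) := by
  refine ⟨hD.precEq hg1 h.1, hD.precEq ?_ h.2⟩
  exact hg1.imp (fun k => k.trans_precEq h.2) fun k => h.1.trans_prec k

end IsDerLike

theorem one_prec_or_prec_one {γ : Γ} (hγ : γ ≠ 0) :
    Prec (1 : Series Γ R) (mono γ) ∨ Prec (mono γ : Series Γ R) 1 := by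
  rw [← mono_zero]
  exact (lt_or_gt_of_ne hγ).imp mono_prec_mono mono_prec_mono

end Transseries

namespace Transseries

variable {Γ : Type (u + 1)} [AddCommGroup Γ] [LinearOrder Γ] [IsOrderedAddMonoid Γ]
  {R : Type w} [Field R] [LinearOrder R] [IsStrictOrderedRing R]
  {log der : Series Γ R → Series Γ R} {comp : Series Γ R → Series Γ R → Series Γ R}
  {x : Series Γ R}

/-! ### Compositions -/

namespace IsTransserialComp

variable {s : Series Γ R}

theorem comp_add (hC : IsTransserialComp log comp) (hs : PosInf s) (f g : Series Γ R) :
    comp (f + g) s = comp f s + comp g s := (hC.stronglyLinear s hs).map_add f g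

theorem comp_const (hC : IsTransserialComp log comp) (hs : PosInf s) (r : R) :
    comp (const r) s = const r := by
  have := (hC.stronglyLinear s hs).map_const_mul r 1
  simpa only [mul_one, hC.comp_one s hs] using this

theorem comp_zero (hC : IsTransserialComp log comp) (hs : PosInf s) : comp 0 s = 0 := by
  rw [← const_zero, hC.comp_const hs]

/-- Monotonicity gives only `≥`; strictness holds because a unit is sent to a unit. -/
theorem comp_pos (hC : IsTransserialComp log comp) (hs : PosInf s) {f : Series Γ R}
    (hf : 0 < f) : 0 < comp f s := by
  have h := hC.comp_mono s hs 0 f hf.le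
  rw [hC.comp_zero hs] at h
  refine lt_of_le_of_ne h fun e => ?_
  have h₁ := hC.comp_mul s hs f f⁻¹
  rw [mul_inv_cancel₀ hf.ne', hC.comp_one s hs, ← e, zero_mul] at h₁
  exact one_ne_zero h₁

theorem comp_lt_comp (hC : IsTransserialComp log comp) (hs : PosInf s) {f g : Series Γ R}
    (hfg : f < g) : comp f s < comp g s := by
  have h := hC.comp_pos hs (sub_pos.2 hfg)
  have e := hC.comp_add hs (g - f) f
  rw [sub_add_cancel] at e
  rw [e]
  linarith

theorem comp_posInf (hC : IsTransserialComp log comp) (hs : PosInf s) {f : Series Γ R}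
    (hf : PosInf f) : PosInf (comp f s) := fun r => by
  rw [← hC.comp_const hs]
  exact hC.comp_lt_comp hs (hf r)

end IsTransserialComp

/-! ### The derivation and the difference operators are asymptotically alike -/

theorem PosInf.ne_const {s : Series Γ R} (h : PosInf s) (r : R) : s ≠ const r := (h r).ne'

theorem IsTransserialDerivation.der_one (hd : IsTransserialDerivation log der) : der 1 = 0 := by
  have := hd.leibniz 1 1
  rw [one_mul, mul_one] at this
  linear_combination -this

theorem IsTransserialDerivation.der_zero (hd : IsTransserialDerivation log der) : der 0 = 0 := by
  have := hd.leibniz 0 0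
  simpa using this

/-- For an infinitesimal `s > 0`, differentiating `s · s⁻¹ = 1` shows that `s'` and `(s⁻¹)'` have
opposite signs, and `s⁻¹` is infinite. -/
theorem IsTransserialDerivation.isDerLike (hd : IsTransserialDerivation log der)
    (hH : IsHField der) : IsDerLike der where
  map_add := hd.stronglyLinear.map_add
  map_const_mul := hd.stronglyLinear.map_const_mul
  pos := hH.der_pos
  neg s hs hs1 := by
    have hi : 0 < s⁻¹ := inv_pos.2 hs
    have h₁ := hH.der_pos _ (PosInf.inv hs hs1)
    have h₂ := hd.leibniz s s⁻¹
    rw [mul_inv_cancel₀ hs.ne', hd.der_one] at h₂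
    by_contra! hc
    have h₃ := mul_nonneg hc hi.le
    have h₄ := mul_pos hs h₁
    linarith

theorem IsConjugacySetting.lt_comp (hT : IsConjugacySetting log der comp x) {s h : Series Γ R}
    (hs : PosInf s) (hxs : x < s) (hh : PosInf h) : h < comp h s := by
  have := (hT.monotone h hh.ne_const).1 (hT.hField.der_pos h hh) x s hT.compIdentity.1 hs hxs
  rwa [hT.compIdentity.2.2] at this

/-- For an infinitesimal `h > 0`, composition increases `h⁻¹` and preserves the product `h · h⁻¹ =
1`, so it decreases `h`. -/
theorem IsConjugacySetting.isDerLike_difference (hT : IsConjugacySetting log der comp x)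
    {s : Series Γ R} (hs : PosInf s) (hxs : x < s) : IsDerLike fun f => comp f s - f where
  map_add f g := by rw [hT.composition.comp_add hs]; ring
  map_const_mul r f := by
    rw [(hT.composition.stronglyLinear s hs).map_const_mul]; ring
  pos h hh := sub_pos.2 (hT.lt_comp hs hxs hh)
  neg h hh hh1 := by
    have hi : 0 < h⁻¹ := inv_pos.2 hh
    have h₁ := hT.lt_comp hs hxs (PosInf.inv hh hh1)
    have h₂ := hT.composition.comp_mul s hs h h⁻¹
    rw [mul_inv_cancel₀ hh.ne', hT.composition.comp_one s hs] at h₂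
    by_contra! hc
    have h₃ := mul_lt_mul' (sub_nonneg.1 hc) h₁ hi.le (hh.trans_le (sub_nonneg.1 hc))
    rw [← h₂, mul_inv_cancel₀ hh.ne'] at h₃
    exact lt_irrefl _ h₃

/-! ### Asymptotic inversion of the difference operator -/

theorem asymp_mul_mono {f : Series Γ R} {α β : Γ} {g : Series Γ R} (hf : Asymp f (mono α))
    (hg : Asymp g (mono β)) : Asymp (f * g) (mono (α + β)) := by
  rw [mono_add]
  exact ⟨(hf.1.mul_right g).trans (hg.1.mul_left _), (hf.2.mul_right _).trans (hg.2.mul_left _)⟩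

/-! ### Series over a subgroup of monomials, and approximate integration there -/

theorem mono_mem_seriesOver {M : AddSubgroup Γ} {μ : Γ} (hμ : μ ∈ M) :
    (mono μ : Series Γ R) ∈ seriesOver R M := by
  intro γ hγ
  by_contra hc
  exact hγ (by rw [coeff_mono, if_neg]; rintro rfl; exact hc hμ)

theorem one_mem_seriesOver (M : AddSubgroup Γ) : (1 : Series Γ R) ∈ seriesOver R M :=
  mono_mem_seriesOver M.zero_mem

theorem add_mem_seriesOver {M : AddSubgroup Γ} {f g : Series Γ R} (hf : f ∈ seriesOver R M)
    (hg : g ∈ seriesOver R M) : f + g ∈ seriesOver R M := by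
  intro γ hγ
  by_contra hc
  have h₁ : coeff f γ = 0 := by_contra fun h => hc (hf h)
  have h₂ : coeff g γ = 0 := by_contra fun h => hc (hg h)
  exact hγ (by rw [coeff_add, h₁, h₂, add_zero])

theorem sub_mem_seriesOver {M : AddSubgroup Γ} {f g : Series Γ R} (hf : f ∈ seriesOver R M)
    (hg : g ∈ seriesOver R M) : f - g ∈ seriesOver R M := by
  intro γ hγ
  by_contra hc
  have h₁ : coeff f γ = 0 := by_contra fun h => hc (hf h)
  have h₂ : coeff g γ = 0 := by_contra fun h => hc (hg h)
  exact hγ (by rw [coeff_sub, h₁, h₂, sub_zero])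

/-- Terms with given derivative, up to asymptotic equivalence. -/
theorem exists_der_asymp (hT : IsConjugacySetting log der comp x) {M : AddSubgroup Γ}
    (hS : IsConjugacySubfield der comp x M) {α : Γ} (hα : α ∈ M) :
    ∃ d ∈ M, d ≠ 0 ∧ Asymp (der (mono d)) (mono α : Series Γ R) := by
  have hmem := mono_mem_seriesOver (R := R) hα
  rw [← hS.der_image] at hmem
  obtain ⟨h, hhM, hh⟩ := hmem
  have hD := hT.derivation.isDerLike hT.hField
  -- Removing the constant term keeps the derivative and makes the dominant monomial different from
  -- `1`, where `IsDerLike.asymp` applies.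
  have e : der (h - const (coeff h 0)) = mono α := by
    rw [hD.map_sub, hh, (hT.hField.ker _).2 ⟨_, rfl⟩, sub_zero]
  have hne : h - const (coeff h 0) ≠ 0 := by
    intro h0
    rw [h0, hT.derivation.der_zero] at e
    exact mono_ne_zero α e.symm
  obtain ⟨d, hd, hda⟩ := exists_asymp_mono hne
  rw [coeff_sub, coeff_const] at hd
  have hd0 : d ≠ 0 := by
    rintro rfl
    rw [if_pos rfl, sub_self] at hd
    exact hd rfl
  rw [if_neg hd0, sub_zero] at hd
  refine ⟨d, hhM hd, hd0, ?_⟩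
  rw [← e]
  exact (hD.asymp (one_prec_or_prec_one hd0) hda).symm

/-- The difference operator is asymptotic to `f ↦ ε f'` on series that vary slowly. -/
theorem difference_asymp_of_taylor (hT : IsConjugacySetting log der comp x) {ε : Series Γ R}
    (hε0 : 0 < ε) (hε1 : Prec ε 1) {d μ : Γ} (hμ : Asymp (der (mono d) * ε) (mono μ))
    (hdμ : d < μ) : Asymp (comp (mono d) (x + ε) - mono d) (mono μ) := by
  have hx := hT.compIdentity.1
  have hcx := hT.compIdentity.2.2
  have hconf : TaylorConfiguration der comp (mono d) x ε := by
    refine ⟨hε1.trans_precEq (posInf_iff.1 hx).2.precEq, fun m hm => ?_⟩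
    obtain rfl : m = d := by_contra fun h => hm (by rw [coeff_mono, if_neg h])
    rw [hcx, hcx]
    exact hμ.1.trans_prec (mono_prec_mono hdμ)
  have hTay := hT.taylor _ _ _ hx hconf
  have hdec := hTay.decreasing
  have hsum := hTay.sum_der.2
  simp only [hcx] at hdec hsum
  have hsmall : ∀ k, Prec (der^[k + 2] (mono d) * ε ^ (k + 2)) (mono μ) := by
    -- `decreasing` says nothing about vanishing terms, but all terms after a vanishing one vanish
    -- too.
    have hzero : ∀ k, der^[k] (mono d) * ε ^ k = 0 → der^[k + 1] (mono d) * ε ^ (k + 1) = 0 := by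
      intro k hk
      rw [Function.iterate_succ_apply', (mul_eq_zero.1 hk).resolve_right (pow_ne_zero _ hε0.ne'),
        hT.derivation.der_zero, zero_mul]
    have step : ∀ k, PrecEq (der^[k] (mono d) * ε ^ k) (mono μ) →
        Prec (der^[k + 1] (mono d) * ε ^ (k + 1)) (mono μ) := by
      intro k hk
      by_cases h0 : der^[k] (mono d) * ε ^ k = 0
      · rw [hzero k h0]
        exact prec_zero_left (mono_ne_zero μ)
      · exact (hdec k h0).trans_precEq hk
    intro k
    induction k with
    | zero => exact step 1 (by simpa using hμ.1)
    | succ k ih => exact step (k + 2) ih.precEq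
  have hcoeff : ∀ γ ≤ μ, coeff (comp (mono d) (x + ε) - mono d) γ = coeff (der (mono d) * ε) γ := by
    intro γ hγ
    rw [coeff_sub, hsum γ, finsum_eq_sum_of_support_subset (s := Finset.range 2)]
    · simp [Finset.sum_range_succ]
    · intro k hk
      rw [Finset.coe_range, Set.mem_Iio]
      by_contra! hk2
      obtain ⟨j, rfl⟩ := Nat.exists_eq_add_of_le' hk2
      exact hk (by simp only [coeff_const_mul, prec_mono_iff.1 (hsmall j) γ hγ, mul_zero])
  rw [asymp_mono_iff] at hμ ⊢
  exact ⟨by rw [hcoeff μ le_rfl]; exact hμ.1, fun γ hγ => by rw [hcoeff γ hγ.le]; exact hμ.2 γ hγ⟩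

/-! ### Logarithms, and monomials that vary fast -/

theorem IsTransserialField.log_one (hL : IsTransserialField log) : log 1 = 0 := by
  have := hL.log_mul 1 1 one_pos one_pos
  rw [mul_one] at this
  linear_combination -this

theorem IsTransserialField.posInf_log_mono (hL : IsTransserialField log) {γ : Γ} (hγ : γ < 0) :
    PosInf (log (mono γ)) := by
  have h1 : (1 : Series Γ R) < mono γ := by
    have := mono_prec_mono (R := R) hγ 1 one_pos
    rwa [mono_zero, const_one, one_mul, abs_one, abs_of_pos (mono_pos γ)] at this
  have h2 := hL.log_lt_log 1 _ one_pos h1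
  rw [hL.log_one] at h2
  obtain ⟨i, hi, hi'⟩ := (pos_iff_coeff _).1 h2
  have hi0 : i < 0 := hL.log_mono γ i hi'.ne'
  intro r
  refine (lt_iff_coeff _ _).2 ⟨i, fun δ hδ => ?_, ?_⟩
  · rw [hi δ hδ, coeff_const, if_neg (hδ.trans hi0).ne]
  · rwa [coeff_const, if_neg hi0.ne]

theorem log_div (hL : IsTransserialField log) {s t : Series Γ R} (hs : 0 < s) (ht : 0 < t) :
    log (s / t) = log s - log t := by
  have := hL.log_mul (s / t) t (div_pos hs ht) ht
  rw [div_mul_cancel₀ s ht.ne'] at this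
  rw [this, add_sub_cancel_right]

/-- Infinite monomials which vary fast compared to `y` are multiplied by at least some constant
`1 + a > 1` by composition with `s`, if `s` moves `y` by at least a constant. -/
theorem exists_mul_le_comp (hT : IsConjugacySetting log der comp x) {s y : Series Γ R}
    (hs : PosInf s) (hxs : x < s) (hy : PosInf y) (hys : PrecEq 1 (comp y s - y)) {γ : Γ}
    (hγ : γ < 0) (hγy : PrecEq (der y * mono γ) (der (mono γ))) :
    ∃ a : R, 0 < a ∧ const (1 + a) * mono γ ≤ comp (mono γ) s := by
  have hL := hT.transserialField
  have hD := hT.derivation.isDerLike hT.hField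
  have hΔ := hT.isDerLike_difference hs hxs
  have hg0 : (0 : Series Γ R) < mono γ := mono_pos γ
  have hl := hL.posInf_log_mono (R := R) hγ
  have hder := hT.derivation.der_log (mono γ) hg0.ne'
  rw [abs_of_pos hg0] at hder
  -- Otherwise `log μ ≺ y`, where `μ = mono γ`, would give `μ' / μ ≺ y'`.
  have hyl : PrecEq y (log (mono γ)) := by
    rw [← not_prec_iff]
    intro h
    refine not_prec_iff.2 ?_ (hD.prec (Or.inl (posInf_iff.1 hy).2) h)
    rw [hder, div_eq_mul_inv]
    have := hγy.mul_right (mono γ)⁻¹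
    rwa [mul_assoc, mul_inv_cancel₀ hg0.ne', mul_one] at this
  obtain ⟨r, hr, h⟩ := hys.trans (hΔ.precEq (Or.inl (posInf_iff.1 hl).2) hyl)
  have hc0 := hT.composition.comp_pos hs hg0
  rw [abs_one, abs_of_pos (hΔ.pos _ hl), hT.composition.comp_log s hs _ hg0,
    ← log_div hL hc0 hg0] at h
  -- The inequality `log u ≤ u - 1` for `u = (μ ∘ s) / μ` turns the lower bound on `log u` into one
  -- on `u - 1`.
  have h₁ := hL.log_le _ (div_pos hc0 hg0)
  refine ⟨r⁻¹, inv_pos.2 hr, ?_⟩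
  rw [← le_div_iff₀ hg0, const_add, const_one]
  have h₂ := mul_le_mul_of_nonneg_left h (const_pos (Γ := Γ) (inv_pos.2 hr)).le
  rw [mul_one, ← mul_assoc, mul_comm (const r⁻¹), const_mul_const_inv hr.ne', one_mul] at h₂
  linarith

/-- Either Taylor expansion applies to an approximate integral of `μ / ε`, or `μ` varies so fast
that one of `h` and `h ∘ s` is at most a proper fraction of the other, and `Δ h` has the size of the
larger. -/
theorem exists_difference_asymp (hT : IsConjugacySetting log der comp x) {M : AddSubgroup Γ}
    (hS : IsConjugacySubfield der comp x M) {ε : Series Γ R} (hεM : ε ∈ seriesOver R M)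
    (hε0 : 0 < ε) (hε1 : Prec ε 1) {μ : Γ} (hμ : μ ∈ M) :
    ∃ n ∈ M, n ≠ 0 ∧ Asymp (comp (mono n) (x + ε) - mono n) (mono μ : Series Γ R) := by
  have hx := hT.compIdentity.1
  have hxs : x < x + ε := lt_add_of_pos_right x hε0
  have hs : PosInf (x + ε) := hx.of_le hxs.le
  have hD := hT.derivation.isDerLike hT.hField
  have hΔ := hT.isDerLike_difference hs hxs
  have hC := hT.composition
  obtain ⟨e, he, hεe⟩ := exists_asymp_mono hε0.ne'
  have heM : e ∈ M := hεM he
  have he0 : 0 < e := by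
    rw [← mono_prec_mono_iff (R := R), mono_zero]
    exact hεe.2.trans_prec hε1
  have key : ∀ {μ d : Γ}, Asymp (der (mono d)) (mono (μ - e) : Series Γ R) → d < μ →
      Asymp (comp (mono d) (x + ε) - mono d) (mono μ) := fun {μ d} hd hlt =>
    difference_asymp_of_taylor hT hε0 hε1 (by simpa using asymp_mul_mono hd hεe) hlt
  -- The yardstick `y` has `y' ≍ 1 / ε`. It is infinite, since `y ≺ x` would give `y' ≺ 1`, and so
  -- `Δ y ≍ 1` by Taylor expansion.
  obtain ⟨y, hyM, hy0, hy⟩ := exists_der_asymp hT hS (M.sub_mem M.zero_mem heM)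
  have hyneg : y < 0 := by
    rw [← mono_prec_mono_iff (R := R), mono_zero]
    refine (posInf_iff.1 hx).2.trans_precEq ?_
    rw [← not_prec_iff]
    intro h
    have h₁ := hD.prec (Or.inl (posInf_iff.1 hx).2) h
    rw [hT.derIdentity.2.2, ← mono_zero] at h₁
    have h₂ := mono_prec_mono_iff.1 (hy.2.trans_prec h₁)
    rw [zero_sub, lt_neg, neg_zero] at h₂
    exact lt_asymm he0 h₂
  have hyinf : PosInf (mono y : Series Γ R) := by
    refine posInf_iff.2 ⟨mono_pos y, ?_⟩
    rw [← mono_zero]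
    exact mono_prec_mono hyneg
  have hΔy : PrecEq 1 (comp (mono y) (x + ε) - mono y) := by
    rw [← mono_zero]
    exact (key hy hyneg).2
  obtain ⟨d, hdM, hd0, hd⟩ := exists_der_asymp hT hS (M.sub_mem hμ heM)
  rcases lt_or_ge d μ with hlt | hle
  · exact ⟨d, hdM, hd0, key hd hlt⟩
  -- If `μ` is the monomial `1`, then `d ≼ 1 ≺ y`, so `d' ≺ y'`, although both are of size `1 / ε`.
  have hμ0 : μ ≠ 0 := by
    rintro rfl
    have hlt : y < d := hyneg.trans_le hle
    exact not_prec_iff.2 (hy.1.trans hd.2)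
      (hD.prec (one_prec_or_prec_one hy0) (mono_prec_mono hlt))
  have hfast : PrecEq (mono (μ - e) : Series Γ R) (der (mono μ)) :=
    hd.2.trans (hD.precEq (one_prec_or_prec_one hμ0) (mono_precEq_mono hle))
  rcases lt_or_gt_of_ne hμ0 with hneg | hpos
  · have hγy : PrecEq (der (mono y) * mono μ) (der (mono μ) : Series Γ R) := by
      refine (hy.1.mul_right _).trans ?_
      rwa [← mono_add, zero_sub, neg_add_eq_sub]
    obtain ⟨a, ha, hle⟩ := exists_mul_le_comp hT hs hxs hyinf hΔy hneg hγy
    -- With `t` the inverse of `s`, the series `h = μ ∘ t` satisfies `Δ h = μ - h`, and `(1 + a) h ≤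
    -- μ` rules out cancellation.
    obtain ⟨t, ht, hts, hst⟩ := hS.group.exists_inv (x + ε)
      ⟨add_mem_seriesOver hS.group.id_mem.1 hεM, hs⟩
    set h := comp (mono μ) t with hh
    have hhM : h ∈ seriesOver R M := hS.comp_mem _ (mono_mem_seriesOver hμ) _ ht
    have hhs : comp h (x + ε) = mono μ := by
      rw [hh, ← hC.assoc _ _ ht.2 hs, hts, hT.compIdentity.2.2]
    have hμinf : PosInf (mono μ : Series Γ R) := by
      refine posInf_iff.2 ⟨mono_pos μ, ?_⟩
      rw [← mono_zero]
      exact mono_prec_mono hneg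
    have hhinf : PosInf h := hC.comp_posInf ht.2 hμinf
    have hah : const (1 + a) * h ≤ mono μ := by
      have := hC.comp_mono t ht.2 _ _ hle
      rwa [(hC.stronglyLinear t ht.2).map_const_mul, ← hC.assoc _ _ hs ht.2, hst,
        hT.compIdentity.2.2] at this
    obtain ⟨n, hn, hna⟩ := exists_asymp_mono hhinf.pos.ne'
    have hn1 : Prec (1 : Series Γ R) (mono n) := (posInf_iff.1 hhinf).2.trans_precEq hna.1
    refine ⟨n, hhM hn, ?_, ((hΔ.asymp (Or.inl hn1) hna).symm).trans ?_⟩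
    · rintro rfl
      rw [← mono_zero, mono_prec_mono_iff] at hn1
      exact lt_irrefl _ hn1
    · simp only [hhs]
      exact asymp_sub ha hhinf.pos hah
  · have hneg : -μ < 0 := neg_lt_zero.2 hpos
    have hprod := mono_mul_mono_neg (R := R) μ
    have hγy : PrecEq (der (mono y) * mono (-μ)) (der (mono (-μ)) : Series Γ R) := by
      have h₁ := hT.derivation.leibniz (mono μ) (mono (-μ))
      rw [hprod, hT.derivation.der_one] at h₁
      -- The quotient rule `(1 / μ)' = -μ' / μ²`; the infinite monomial `1 / μ` varies as fast as
      -- `μ`.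
      have h₂ : der (mono (-μ)) = -(der (mono μ) * (mono (-μ) * mono (-μ))) := by
        linear_combination mono (-μ) * (-h₁) - der (mono (-μ)) * hprod
      rw [h₂]
      refine ((hy.1.mul_right _).trans ?_).neg_right
      have h₃ := hfast.mul_right (mono (-μ) * mono (-μ))
      rw [← mono_add, ← mono_add] at h₃ ⊢
      rwa [show 0 - e + -μ = μ - e + (-μ + -μ) by abel]
    obtain ⟨a, ha, hle⟩ := exists_mul_le_comp hT hs hxs hyinf hΔy hneg hγy
    refine ⟨μ, hμ, hμ0, ?_⟩
    have hc0 := hC.comp_pos hs (mono_pos (R := R) μ)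
    have hc := hC.comp_mul _ hs (mono μ) (mono (-μ))
    rw [hprod, hC.comp_one _ hs] at hc
    have hah : const (1 + a) * comp (mono μ) (x + ε) ≤ mono μ := by
      have h₁ := mul_le_mul_of_nonneg_left hle (mul_pos (mono_pos (R := R) μ) hc0).le
      calc const (1 + a) * comp (mono μ) (x + ε)
          = mono μ * comp (mono μ) (x + ε) * (const (1 + a) * mono (-μ)) := by
            linear_combination -(const (1 + a) * comp (mono μ) (x + ε)) * hprod
        _ ≤ _ := h₁
        _ = mono μ := by linear_combination -(mono μ) * hc
    have := asymp_sub ha hc0 hah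
    rw [← neg_sub]
    exact ⟨this.1.neg_left, this.2.neg_right⟩

/-- The difference operator is surjective. -/
theorem exists_difference_eq (hT : IsConjugacySetting log der comp x) {M : AddSubgroup Γ}
    (hS : IsConjugacySubfield der comp x M) {ε : Series Γ R} (hεM : ε ∈ seriesOver R M)
    (hε0 : 0 < ε) (hε1 : Prec ε 1) {g : Series Γ R} (hg : g ∈ seriesOver R M) :
    ∃ V ∈ seriesOver R M, comp V (x + ε) - V = g ∧ coeff V 0 = 0 := by
  have hx := hT.compIdentity.1
  have hxs : x < x + ε := lt_add_of_pos_right x hε0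
  have hs : PosInf (x + ε) := hx.of_le hxs.le
  have hΔ := hT.isDerLike_difference hs hxs
  choose! n hnM hn0 hn using fun μ (hμ : μ ∈ M) =>
    exists_difference_asymp hT hS hεM hε0 hε1 hμ
  -- Were the order reversed, `Δ` would preserve `≼` between the chosen monomials and give `μ ≼ ν`,
  -- against `ν ≺ μ`.
  have hmono : StrictMonoOn n M := by
    intro μ hμ ν hν hlt
    by_contra! hle
    refine not_prec_iff.2 ?_ (mono_prec_mono (R := R) hlt)
    exact (hn μ hμ).2.trans ((hΔ.precEq (one_prec_or_prec_one (hn0 ν hν))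
      (mono_precEq_mono hle)).trans (hn ν hν).1)
  have hsupp : ∀ μ ∈ M, supp (comp (mono (n μ)) (x + ε) - mono (n μ)) ⊆ M := fun μ hμ => by
    have hmem := mono_mem_seriesOver (R := R) (hnM μ hμ)
    exact sub_mem_seriesOver
      (hS.comp_mem _ hmem _ ⟨add_mem_seriesOver hS.group.id_mem.1 hεM, hs⟩) hmem
  obtain ⟨V, hV, hVg⟩ := ((hT.composition.stronglyLinear _ hs).sub
    isStronglyLinear_id).exists_preimage hmono hn hsupp g hg
  refine ⟨V, hV.trans (Set.image_subset_iff.2 hnM), hVg, ?_⟩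
  by_contra hc
  obtain ⟨μ, hμ, h⟩ := hV hc
  exact hn0 μ hμ h

/-- Abel's equation for infinitesimal perturbations of the identity. -/
theorem exists_abel (hT : IsConjugacySetting log der comp x) {M : AddSubgroup Γ}
    (hS : IsConjugacySubfield der comp x M) {ε : Series Γ R} (hεM : ε ∈ seriesOver R M)
    (hε0 : 0 < ε) (hε1 : Prec ε 1) :
    ∃ V ∈ posInfOver R M, comp V (x + ε) = V + 1 := by
  have hx := hT.compIdentity.1
  have hxs : x < x + ε := lt_add_of_pos_right x hε0
  have hs : PosInf (x + ε) := hx.of_le hxs.le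
  have hΔ := hT.isDerLike_difference hs hxs
  obtain ⟨V, hVM, hV, hV0⟩ := exists_difference_eq hT hS hεM hε0 hε1 (one_mem_seriesOver M)
  refine ⟨V, ⟨hVM, ?_⟩, by rw [← hV]; ring⟩
  -- If `V ≺ 1 ≺ x`, then `1 = Δ V ≺ Δ x = ε`. The vanishing constant term excludes `V ≍ 1`, so `V`
  -- is infinite, and the sign of `Δ V` makes it positive.
  have hV1 : ¬ Prec V 1 := by
    intro h
    have hx1 := (posInf_iff.1 hx).2
    have h₁ := hΔ.prec (Or.inl hx1) (h.trans_precEq hx1.precEq)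
    simp only [hV, hT.compIdentity.2.1 _ hs, add_sub_cancel_left] at h₁
    exact not_prec_iff.2 hε1.precEq h₁
  have hVne : V ≠ 0 := by
    rintro rfl
    exact hV1 (prec_zero_left one_ne_zero)
  obtain ⟨d, hd, hVd⟩ := exists_asymp_mono hVne
  have hd0 : d ≠ 0 := by
    rintro rfl
    exact hd hV0
  have h1V : Prec 1 V := by
    rcases one_prec_or_prec_one (R := R) hd0 with h | h
    · exact h.trans_precEq hVd.2
    · exact absurd (hVd.1.trans_prec h) hV1
  rcases lt_or_gt_of_ne hVne with h | h
  · have h₁ := hΔ.pos (-V) (posInf_iff.2 ⟨neg_pos.2 h, by rwa [Prec, abs_neg]⟩)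
    rw [hΔ.map_neg] at h₁
    simp only [hV] at h₁
    exact absurd h₁ (by norm_num)
  · exact posInf_iff.2 ⟨h, h1V⟩

/-! ### Groups in which all elements greater than `1` are conjugate -/

section Group

variable {G : Type*} [Group G] [LinearOrder G]

theorem one_lt_of_isConj (hmul : ∀ a b c : G, a < b → a * c < b * c ∧ c * a < c * b) {a b : G}
    (h : IsConj a b) (ha : 1 < a) : 1 < b := by
  obtain ⟨c, rfl⟩ := isConj_iff.1 h
  have := (hmul _ _ c⁻¹ (hmul _ _ c ha).2).1
  rwa [mul_one, mul_inv_cancel] at this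

theorem one_lt_inv_of_lt_one (hmul : ∀ a b c : G, a < b → a * c < b * c ∧ c * a < c * b) {a : G}
    (ha : a < 1) : 1 < a⁻¹ := by
  have := (hmul _ _ a⁻¹ ha).1
  rwa [mul_inv_cancel, one_mul] at this

/-- Inversion carries conjugates of `t` to conjugates of `t⁻¹`, and conjugation preserves being
above `1`, so the classes of `t` and `t⁻¹` differ. -/
theorem card_conjClasses_eq_three
    (hmul : ∀ a b c : G, a < b → a * c < b * c ∧ c * a < c * b) {t : G}
    (ht : 1 < t) (hconj : ∀ g : G, 1 < g → IsConj g t) : Nat.card (ConjClasses G) = 3 := by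
  have hinv : ∀ a b : G, IsConj a b → IsConj a⁻¹ b⁻¹ := by
    intro a b h
    obtain ⟨c, rfl⟩ := isConj_iff.1 h
    exact isConj_iff.2 ⟨c, by group⟩
  have h₁ : (ConjClasses.mk 1 : ConjClasses G) ≠ ConjClasses.mk t := fun h =>
    ht.ne' (isConj_one_right.1 (ConjClasses.mk_eq_mk_iff_isConj.1 h))
  have h₂ : (ConjClasses.mk 1 : ConjClasses G) ≠ ConjClasses.mk t⁻¹ := fun h =>
    ht.ne' (inv_eq_one.1 (isConj_one_right.1 (ConjClasses.mk_eq_mk_iff_isConj.1 h)))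
  have h₃ : (ConjClasses.mk t : ConjClasses G) ≠ ConjClasses.mk t⁻¹ := fun h => by
    have h := one_lt_of_isConj hmul (ConjClasses.mk_eq_mk_iff_isConj.1 h) ht
    have := (hmul _ _ t h).1
    rw [one_mul, inv_mul_cancel] at this
    exact lt_asymm ht this
  classical
  have huniv : (Set.univ : Set (ConjClasses G)) =
      ({ConjClasses.mk 1, ConjClasses.mk t, ConjClasses.mk t⁻¹} : Finset (ConjClasses G)) := by
    refine (Set.eq_univ_of_forall fun c => ?_).symm
    obtain ⟨g, rfl⟩ := ConjClasses.mk_surjective c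
    simp only [Finset.coe_insert, Finset.coe_singleton, Set.mem_insert_iff, Set.mem_singleton_iff,
      ConjClasses.mk_eq_mk_iff_isConj]
    rcases lt_trichotomy g 1 with h | rfl | h
    · right; right
      simpa using hinv _ _ (hconj _ (one_lt_inv_of_lt_one hmul h))
    · exact Or.inl (IsConj.refl _)
    · exact Or.inr (Or.inl (hconj g h))
  rw [← Set.ncard_univ, huniv, Set.ncard_coe_finset, Finset.card_eq_three]
  exact ⟨_, _, _, h₁, h₂, h₃, rfl⟩

/-- A nontrivial normal subgroup contains an element above `1`, hence `t`, hence every element above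
`1` and their inverses. -/
theorem isSimpleGroup_of_isConj
    (hmul : ∀ a b c : G, a < b → a * c < b * c ∧ c * a < c * b) {t : G}
    (ht : 1 < t) (hconj : ∀ g : G, 1 < g → IsConj g t) : IsSimpleGroup G where
  exists_pair_ne := ⟨1, t, ht.ne⟩
  eq_bot_or_eq_top_of_normal N hN := by
    refine or_iff_not_imp_left.2 fun hbot => ?_
    obtain ⟨⟨g, hg⟩, hg1⟩ := N.ne_bot_iff_exists_ne_one.1 hbot
    have hconjN : ∀ a b : G, IsConj a b → a ∈ N → b ∈ N := by
      intro a b h ha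
      obtain ⟨c, rfl⟩ := isConj_iff.1 h
      exact hN.conj_mem a ha c
    have hg1' : g ≠ 1 := fun h => hg1 (Subtype.ext h)
    have htN : t ∈ N := by
      rcases lt_or_gt_of_ne hg1' with h | h
      · exact hconjN _ _ (hconj _ (one_lt_inv_of_lt_one hmul h)) (N.inv_mem hg)
      · exact hconjN _ _ (hconj _ h) hg
    refine (Subgroup.eq_top_iff' N).2 fun a => ?_
    rcases lt_trichotomy a 1 with h | rfl | h
    · exact N.inv_mem_iff.1 (hconjN _ _ (hconj _ (one_lt_inv_of_lt_one hmul h)).symm htN)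
    · exact N.one_mem
    · exact hconjN _ _ (hconj _ h).symm htN

end Group

end Transseries

/-! ### Abel's equation in general, and the conjugacy classes -/

theorem theorem4p6 {Γ : Type (u + 1)} [AddCommGroup Γ] [LinearOrder Γ] [IsOrderedAddMonoid Γ]
    {R : Type w} [Field R] [LinearOrder R] [IsStrictOrderedRing R]
    (log der : Series Γ R → Series Γ R) (comp : Series Γ R → Series Γ R → Series Γ R)
    (x : Series Γ R) (hT : IsConjugacySetting log der comp x)
    (M : AddSubgroup Γ) (hS : IsConjugacySubfield der comp x M)
    (hU : ∃ U : AddSubgroup Γ, IsSteepConjugate log der comp x M U) :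
    (∀ f ∈ posInfOver R M, x < f → ∃ V ∈ posInfOver R M, comp V f = V + 1) ∧
    (∀ f ∈ posInfOver R M, ∀ g ∈ posInfOver R M, ∀ h ∈ posInfOver R M, f < g →
      comp f h < comp g h ∧ comp h f < comp h g) ∧
    (letI : Group (posInfOver R M) := hS.group.group;
      Nat.card (ConjClasses (posInfOver R M)) = 3 ∧ IsSimpleGroup (posInfOver R M)) := by
  have hC := hT.composition
  have habel : ∀ f ∈ posInfOver R M, x < f → ∃ V ∈ posInfOver R M, comp V f = V + 1 := by
    intro f hf hxf
    obtain ⟨U, hU⟩ := hU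
    obtain ⟨V₀, hV₀, ε, hεU, hε1, hε0, hV₀f⟩ := hU.conj f hf hxf
    obtain ⟨V, hV, hVε⟩ := exists_abel hT hS
      (fun γ hγ => hU.steepSubfield.le (hεU hγ)) hε0 hε1
    have hs : PosInf (x + ε) := hT.compIdentity.1.of_le (le_add_of_nonneg_right hε0.le)
    refine ⟨comp V V₀, hS.group.comp_mem V hV V₀ hV₀, ?_⟩
    rw [← hC.assoc _ _ hV₀.2 hf.2, hV₀f, hC.assoc _ _ hs hV₀.2, hVε, hC.comp_add hV₀.2,
      hC.comp_one _ hV₀.2]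
  have hlt : ∀ f ∈ posInfOver R M, ∀ g ∈ posInfOver R M, ∀ h ∈ posInfOver R M, f < g →
      comp f h < comp g h ∧ comp h f < comp h g := fun f hf g hg h hh hfg =>
    ⟨hC.comp_lt_comp hh.2 hfg, (hT.monotone h hh.2.ne_const).1 (hT.hField.der_pos h hh.2)
      f g hf.2 hg.2 hfg⟩
  refine ⟨habel, hlt, ?_⟩
  let _ : Group (posInfOver R M) := hS.group.group
  have hxM := hS.group.id_mem
  have hx1 : x < x + 1 := lt_add_one x
  have hx1M : x + 1 ∈ posInfOver R M :=
    ⟨add_mem_seriesOver hxM.1 (one_mem_seriesOver M), hxM.2.of_le hx1.le⟩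
  have hmul : ∀ a b c : posInfOver R M, a < b → a * c < b * c ∧ c * a < c * b :=
    fun a b c h => hlt a a.2 b b.2 c c.2 h
  -- Abel's equation reads `V ∘ f = (x + 1) ∘ V`, a conjugacy with this translation.
  let t : posInfOver R M := ⟨x + 1, hx1M⟩
  have ht : 1 < t := hx1
  have hconj : ∀ g : posInfOver R M, 1 < g → IsConj g t := by
    intro g hg
    obtain ⟨V, hV, hVg⟩ := habel g g.2 hg
    refine isConj_iff.2 ⟨⟨V, hV⟩, mul_inv_eq_of_eq_mul (Subtype.ext ?_)⟩
    change comp V g = comp (x + 1) V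
    rw [hVg, hC.comp_add hV.2, hC.comp_one _ hV.2, hT.compIdentity.2.1 _ hV.2]
  exact ⟨card_conjClasses_eq_three hmul ht hconj, isSimpleGroup_of_isConj hmul ht hconj⟩
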